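/- **Proposition (Soundness and completeness of qOTL with unbounded duality).** *Setting.* Let $V_1,V_2$ be finite sets of quantum variables, each variable having a finite dimension $\ge 1$, and let $\mathcal H_1,\mathcal H_2$ be the corresponding finite-dimensional state spaces. qWhile programs over $V_i$ are built from $\mathbf{skip}$, initialization $Q:=|w\rangle$ of a register $Q\subseteq V_i$ in a unit vector $w$, unitaries $Q:=U[Q]$, sequential composition $c;c'$, $\mathbf{if}\,(\square m\cdot M[Q]=m\to c_m)\,\mathbf{fi}$ with a finite-outcome measurement $M$ ($\sum_m M_m^\dagger M_m=I$), and $\mathbf{while}\,M[Q]=1\,\mathbf{do}\,c\,\mathbf{od}$ with a two-outcome measurement. Programs are identified up to associativity of $;$ and $\mathbf{skip};c=c=c;\mathbf{skip}$. The denotational semantics $[\![c]\!]$ is the usual one, with $[\![\mathbf{while}]\!](\rho)=\sum_{k\ge 0}M_0\big(([\![c]\!]\circ \mathcal M_1)^k(\rho)\big)M_0^\dagger$, where $\mathcal M_1(\tau)=M_1\tau M_1^\dagger$. A program $c$ is almost surely terminating (AST) if $\operatorname{tr}[\![c]\!](\rho)=\operatorname{tr}\rho$ for all partial density operators $\rho$.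 *Assertions.* An infinite-valued predicate is $A=\sum_j\lambda_jX_j$ with $\lambda_j\in[0,+\infty]$ and pairwise orthogonal projections $X_j$ with $\sum_jX_j=I$; $\operatorname{tr}(A\rho)=\sum_j\lambda_j\operatorname{tr}(X_j\rho)$ with $0\cdot\infty=0$. Sums and $\sum_kK_k^\dagger A_kK_k$ are defined accordingly, and $A\sqsubseteq B$ means $\langle v|A|v\rangle\le\langle v|B|v\rangle$ for all $v$. Assertions $\psi,\phi$ are infinite-valued predicates on $\mathcal H_1\otimes\mathcal H_2$. *Validity.* A partial coupling of partial density operators $\rho_1,\rho_2$ is a positive $\sigma$ on $\mathcal H_1\otimes \mathcal H_2$ with $\operatorname{tr}_2\sigma\sqsubseteq\rho_1$, $\operatorname{tr}_1\sigma\sqsubseteq\rho_2$ and $\operatorname{tr}\rho_1+\operatorname{tr}\rho_2\le 1+\operatorname{tr}\sigma$; a coupling is a positive $\sigma$ with $\operatorname{tr}_2\sigma=\rho_1$, $\operatorname{tr}_1\sigma=\rho_2$. The judgment $\{\psi\}\,c_1\sim c_2\,\{\phi\}$ is valid, $\models\{\psi\}\,c_1\sim c_2\,\{\phi\}$, if for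 every density operator $\rho$ on $\mathcal H_1\otimes\mathcal H_2$ there is a partial coupling $\sigma$ of $[\![c_1]\!](\operatorname{tr}_2\rho)$ and $[\![c_2]\!](\operatorname{tr}_1\rho)$ with $\operatorname{tr}(\phi\sigma)\le\operatorname{tr}(\psi\rho)$. *Proof system.* $\vdash$ is the least relation closed under the following rules, where left operators act as $K\otimes I$ and right operators as $I\otimes K$. - One-sided: $\vdash\{\sum_i|i\rangle\langle w|\psi|w\rangle\langle i|\}\;Q:=|w\rangle\sim\mathbf{skip}\;\{\psi\}$; $\vdash\{U^\dagger\psi U\}\;Q:=U[Q]\sim\mathbf{skip}\;\{\psi\}$; from $\vdash\{\xi_m\}c_m\sim c_2\{\phi\}$ for all $m$ infer $\vdash\{\sum_mM_m^\dagger\xi_mM_m\}\,\mathbf{if}\sim c_2\,\{\phi\}$; with $W=M_0^\dagger\phi M_0+M_1^\dagger\xi M_1$, from $\vdash\{\xi\}c\sim\mathbf{skip}\{W\}$ infer $\vdash\{W\}\,\mathbf{while}\sim\mathbf{skip}\,\{\phi\}$; and the symmetric right rules. - Two-sided: $\vdash\{\psi\}\mathbf{skip}\sim\mathbf{skip}\{\psi\}$;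 two initializations or two unitaries at once; sequential composition; from $\vdash\{\xi_m\}c_m\sim c_m'\{\phi\}$ for all $m$ and the measurement condition $M\approx M':\psi\Rightarrow(\xi_m)_m$ infer $\vdash\{\psi\}\,\mathbf{if}\sim\mathbf{if}\,\{\phi\}$; from $\vdash\{\xi\}c\sim c'\{\psi\}$ and $M\approx M':\psi\Rightarrow(\phi,\xi)$ infer $\vdash\{\psi\}\,\mathbf{while}\sim\mathbf{while}\,\{\phi\}$. The condition $M\approx M':\psi\Rightarrow(\xi_m)_m$ says that for every partial density operator $\rho$ with $\operatorname{tr}(\psi\rho)<\infty$ there are couplings $\sigma_m$ of $M_m(\operatorname{tr}_2\rho)M_m^\dagger$ and $M'_m(\operatorname{tr}_1\rho)M_m'^\dagger$ with $\sum_m\operatorname{tr}(\xi_m\sigma_m)\le\operatorname{tr}(\psi\rho)$. - Structural: from $\psi'\sqsubseteq\psi$, $\vdash\{\psi'\}c_1\sim c_2\{\phi'\}$, $\phi\sqsubseteq\phi'$ infer $\vdash\{\psi\}c_1\sim c_2\{\phi\}$. - Unbounded duality (and its special case for $\phi$ without eigenvalue $+\infty$): if $c_1,c_2$ are AST and $\vdash\{\psi+n\cdot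 id\}c_1\sim c_2\{\phi_1\otimes id+id\otimes\phi_2\}$ for all $n\in\mathbb N$ and positive operators $\phi_1$ on $\mathcal H_1$, $\phi_2$ on $\mathcal H_2$ with $\phi_1\otimes id+id\otimes\phi_2\sqsubseteq\phi+n\cdot id$, infer $\vdash\{\psi\}c_1\sim c_2\{\phi\}$. *Claim.* For all AST programs $c_1$ over $V_1$ and $c_2$ over $V_2$, and all infinite-valued assertions $\psi,\phi$, $$\vdash\{\psi\}\,c_1\sim c_2\,\{\phi\}\quad\Longleftrightarrow\quad\models\{\psi\}\,c_1\sim c_2\,\{\phi\}.$$ The same equivalence holds when validity is instead defined by requiring, for every partial density operator $\rho$ on $\mathcal H_1\otimes\mathcal H_2$, a coupling $\sigma$ of the two outputs with $\operatorname{tr}(\phi\sigma)\le\operatorname{tr}(\psi\rho)$. -/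

import Mathlib

open scoped Matrix Kronecker ENNReal ComplexOrder

noncomputable section

namespace QOTL

/-! ### Infinite-valued predicates -/

/-- An infinite-valued predicate on the Hilbert space `ℂ^ι`, i.e. an operator
`A = ∑ j, λ j • X j` with eigenvalues `λ j ∈ [0, +∞]` and pairwise orthogonal
eigenprojections `X j` summing to the identity.  Such an `A` is the same as the pair of
the positive operator `fin = ∑ (λ j < ∞), λ j • X j` and the projection
`inf = ∑ (λ j = ∞), X j`, which are orthogonal to one another; one writes
`A = fin + ∞ • inf`. -/
@[ext]
structure InfPred (ι : Type*) [Fintype ι] [DecidableEq ι] where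
  /-- the finite part -/
  fin : Matrix ι ι ℂ
  /-- the projection onto the eigenspace of the eigenvalue `+∞` -/
  inf : Matrix ι ι ℂ
  fin_posSemidef : fin.PosSemidef
  inf_isHermitian : inf.IsHermitian
  inf_mul_inf : inf * inf = inf
  inf_mul_fin : inf * fin = 0

/-- The projection onto the support (orthogonal complement of the kernel) of a Hermitian
matrix. -/
def suppProj {ι : Type*} [Fintype ι] [DecidableEq ι] (S : Matrix ι ι ℂ) : Matrix ι ι ℂ :=
  cfc (fun x : ℝ => if x = 0 then (0 : ℝ) else 1) S

section suppProj
variable {ι : Type*} [Fintype ι] [DecidableEq ι]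

theorem suppProj_isHermitian (S : Matrix ι ι ℂ) : (suppProj S).IsHermitian :=
  cfc_predicate (R := ℝ) (p := IsSelfAdjoint) _ S

theorem suppProj_mul_self (S : Matrix ι ι ℂ) : suppProj S * suppProj S = suppProj S := by
  by_cases hS : IsSelfAdjoint S
  · have hc : ContinuousOn (fun x : ℝ => if x = 0 then (0 : ℝ) else 1) (spectrum ℝ S) :=
      (Matrix.finite_real_spectrum (A := S)).continuousOn _
    unfold suppProj
    rw [← cfc_mul _ _ S hc hc]
    congr 1
    ext x
    split_ifs <;> simp
  · simp [suppProj, cfc_apply_of_not_predicate S hS]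

end suppProj

namespace InfPred

variable {ι : Type*} [Fintype ι] [DecidableEq ι]

/-- The expectation `tr (A ρ) ∈ [0, +∞]` of a predicate in a positive operator `ρ`, with the
convention `0 * ∞ = 0`: it is infinite unless `ρ` is orthogonal to the `+∞`-eigenspace. -/
def expect (A : InfPred ι) (ρ : Matrix ι ι ℂ) : ℝ≥0∞ :=
  open Classical in
  if A.inf * ρ = 0 then ENNReal.ofReal (A.fin * ρ).trace.re else ⊤

/-- The quadratic form `⟨v|A|v⟩ ∈ [0, +∞]`. -/
def qform (A : InfPred ι) (v : ι → ℂ) : ℝ≥0∞ :=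
  A.expect (Matrix.vecMulVec v (star v))

/-- The Löwner order. -/
instance : LE (InfPred ι) where
  le A B := ∀ v : ι → ℂ, A.qform v ≤ B.qform v

/-- A positive operator as a predicate. -/
def ofPos (P : Matrix ι ι ℂ) (hP : P.PosSemidef) : InfPred ι where
  fin := P
  inf := 0
  fin_posSemidef := hP
  inf_isHermitian := Matrix.isHermitian_zero
  inf_mul_inf := by simp
  inf_mul_fin := by simp

/-- The predicate `P + ∞ • S` for a positive operator `P` and a positive operator `S`: it is
`+∞` on the support of `S`, and `P` compressed to the kernel of `S` elsewhere. -/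
def ofParts (P S : Matrix ι ι ℂ) (hP : P.PosSemidef) : InfPred ι where
  fin := (1 - suppProj S) * P * (1 - suppProj S)
  inf := suppProj S
  fin_posSemidef := by
    have h : (1 - suppProj S)ᴴ = 1 - suppProj S := by
      rw [Matrix.conjTranspose_sub, Matrix.conjTranspose_one, suppProj_isHermitian S]
    have := hP.mul_mul_conjTranspose_same (1 - suppProj S)
    rwa [h] at this
  inf_isHermitian := suppProj_isHermitian S
  inf_mul_inf := suppProj_mul_self S
  inf_mul_fin := by
    have h : suppProj S * (1 - suppProj S) = 0 := by
      rw [mul_sub, suppProj_mul_self, mul_one, sub_self]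
    rw [← mul_assoc, ← mul_assoc, h, zero_mul, zero_mul]

/-- Addition: `A + B = (fin A + fin B) + ∞ • (inf A ∨ inf B)`. -/
instance : Add (InfPred ι) where
  add A B := ofParts (A.fin + B.fin) (A.inf + B.inf) (A.fin_posSemidef.add B.fin_posSemidef)

/-- The predicate `n • id`. -/
def natId (n : ℕ) : InfPred ι :=
  ofPos ((n : ℂ) • (1 : Matrix ι ι ℂ)) (Matrix.PosSemidef.one.smul (Nat.cast_nonneg n))

/-- The predicate `∑ k, (K k)† (A k) (K k)`. -/
def kraus {κ : Type*} [Fintype κ] (K : κ → Matrix ι ι ℂ) (A : κ → InfPred ι) : InfPred ι :=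
  ofParts (∑ k, (K k)ᴴ * (A k).fin * K k) (∑ k, (K k)ᴴ * (A k).inf * K k)
    (Matrix.posSemidef_sum _ fun k _ => (A k).fin_posSemidef.conjTranspose_mul_mul_same (K k))

end InfPred

/-! ### Quantum registers and measurements -/

section Registers

variable {V : Type*} [Fintype V] [DecidableEq V]

/-- The computational basis of the state space of all quantum variables, where the variable
`v` has dimension `d v`.  The state space itself is `ℂ ^ Basis d`. -/
abbrev Basis (d : V → ℕ) : Type _ := ∀ v : V, Fin (d v)

/-- The computational basis of the state space of the register `Q`. -/
abbrev RegBasis (d : V → ℕ) (Q : Finset V) : Type _ := ∀ v : Q, Fin (d v)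

/-- The operator `A` on the register `Q`, extended by the identity to all variables. -/
def lift {d : V → ℕ} (Q : Finset V) (A : Matrix (RegBasis d Q) (RegBasis d Q) ℂ) :
    Matrix (Basis d) (Basis d) ℂ :=
  Matrix.of fun x y =>
    if ∀ v, v ∉ Q → x v = y v then A (fun v => x v) (fun v => y v) else 0

/-- A measurement on the register `Q` with `n` outcomes. -/
structure Measurement (d : V → ℕ) (Q : Finset V) (n : ℕ) where
  op : Fin n → Matrix (RegBasis d Q) (RegBasis d Q) ℂ
  complete : ∑ m, (op m)ᴴ * op m = 1

/-- The measurement operator for the outcome `m`, on the space of all variables. -/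
def Measurement.lifted {d : V → ℕ} {Q : Finset V} {n : ℕ} (M : Measurement d Q n) (m : Fin n) :
    Matrix (Basis d) (Basis d) ℂ :=
  lift Q (M.op m)

/-- The operator `|w⟩⟨i|` on the register `Q`, on the space of all variables. -/
def initKraus {d : V → ℕ} (Q : Finset V) (w : RegBasis d Q → ℂ) (i : RegBasis d Q) :
    Matrix (Basis d) (Basis d) ℂ :=
  lift Q (Matrix.vecMulVec w (Pi.single i 1))

end Registers

/-! ### The language qWhile -/

section Language

variable {V : Type*} [Fintype V] [DecidableEq V]

/-- qWhile programs over the quantum variables `V`. -/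
inductive Prog (d : V → ℕ) : Type _
  /-- `skip` -/
  | skip : Prog d
  /-- `Q := |w⟩` -/
  | init (Q : Finset V) (w : RegBasis d Q → ℂ) (hw : ∑ i, ‖w i‖ ^ 2 = 1) : Prog d
  /-- `Q := U[Q]` -/
  | apply (Q : Finset V) (U : Matrix.unitaryGroup (RegBasis d Q) ℂ) : Prog d
  /-- `c; c'` -/
  | seq (c c' : Prog d) : Prog d
  /-- `if (□ m · M[Q] = m → S m) fi` -/
  | cond (Q : Finset V) (n : ℕ) (M : Measurement d Q n) (S : Fin n → Prog d) : Prog d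
  /-- `while M[Q] = 1 do c od` -/
  | loop (Q : Finset V) (M : Measurement d Q 2) (c : Prog d) : Prog d

namespace Prog

/-- The denotational semantics. -/
def sem {d : V → ℕ} : Prog d → Matrix (Basis d) (Basis d) ℂ → Matrix (Basis d) (Basis d) ℂ
  | skip, ρ => ρ
  | init Q w _, ρ => ∑ i, initKraus Q w i * ρ * (initKraus Q w i)ᴴ
  | apply Q U, ρ => lift Q U.1 * ρ * (lift Q U.1)ᴴ
  | seq c c', ρ => c'.sem (c.sem ρ)
  | cond _ _ M S, ρ => ∑ m, (S m).sem (M.lifted m * ρ * (M.lifted m)ᴴ)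
  | loop _ M c, ρ =>
      ∑' k : ℕ, M.lifted 0 *
        (fun τ => c.sem (M.lifted 1 * τ * (M.lifted 1)ᴴ))^[k] ρ * (M.lifted 0)ᴴ

/-- Almost sure termination: every (partial) state is mapped to a state of the same trace. -/
def AST {d : V → ℕ} (c : Prog d) : Prop :=
  ∀ ρ : Matrix (Basis d) (Basis d) ℂ, ρ.PosSemidef → ρ.trace.re ≤ 1 →
    (c.sem ρ).trace = ρ.trace

/-- The usual syntactic identifications of programs: `;` is associative with unit `skip`. -/
inductive Same {d : V → ℕ} : Prog d → Prog d → Prop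
  | refl (c) : Same c c
  | symm {c c'} : Same c c' → Same c' c
  | trans {c c' c''} : Same c c' → Same c' c'' → Same c c''
  | skip_seq (c) : Same (seq skip c) c
  | seq_skip (c) : Same (seq c skip) c
  | assoc (c c' c'') : Same (seq (seq c c') c'') (seq c (seq c' c''))
  | seq_congr {a a' b b'} : Same a a' → Same b b' → Same (seq a b) (seq a' b')
  | cond_congr (Q n) (M : Measurement d Q n) {S S' : Fin n → Prog d} :
      (∀ m, Same (S m) (S' m)) → Same (cond Q n M S) (cond Q n M S')
  | loop_congr (Q) (M : Measurement d Q 2) {c c'} :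
      Same c c' → Same (loop Q M c) (loop Q M c')

end Prog

end Language

/-! ### Couplings -/

section Couplings

variable {ι₁ ι₂ : Type*} [Fintype ι₁] [Fintype ι₂] [DecidableEq ι₁] [DecidableEq ι₂]

/-- The partial trace over the second system. -/
def trace₂ (σ : Matrix (ι₁ × ι₂) (ι₁ × ι₂) ℂ) : Matrix ι₁ ι₁ ℂ :=
  Matrix.of fun i i' => ∑ j, σ (i, j) (i', j)

/-- The partial trace over the first system. -/
def trace₁ (σ : Matrix (ι₁ × ι₂) (ι₁ × ι₂) ℂ) : Matrix ι₂ ι₂ ℂ :=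
  Matrix.of fun j j' => ∑ i, σ (i, j) (i, j')

/-- `σ` is a coupling of `ρ₁` and `ρ₂`. -/
structure IsCoupling (σ : Matrix (ι₁ × ι₂) (ι₁ × ι₂) ℂ)
    (ρ₁ : Matrix ι₁ ι₁ ℂ) (ρ₂ : Matrix ι₂ ι₂ ℂ) : Prop where
  posSemidef : σ.PosSemidef
  trace₂_eq : trace₂ σ = ρ₁
  trace₁_eq : trace₁ σ = ρ₂

/-- `σ` is a partial coupling of the partial density operators `ρ₁` and `ρ₂`.  If
`ρ₁` and `ρ₂` have trace one, then this says that `σ` is a coupling. -/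
structure IsPartialCoupling (σ : Matrix (ι₁ × ι₂) (ι₁ × ι₂) ℂ)
    (ρ₁ : Matrix ι₁ ι₁ ℂ) (ρ₂ : Matrix ι₂ ι₂ ℂ) : Prop where
  posSemidef : σ.PosSemidef
  trace₂_le : (ρ₁ - trace₂ σ).PosSemidef
  trace₁_le : (ρ₂ - trace₁ σ).PosSemidef
  trace_le : ρ₁.trace.re + ρ₂.trace.re ≤ 1 + σ.trace.re

/-- The split predicate `φ₁ ⊗ id + id ⊗ φ₂` of two positive operators. -/
def split (φ₁ : {P : Matrix ι₁ ι₁ ℂ // P.PosSemidef}) (φ₂ : {P : Matrix ι₂ ι₂ ℂ // P.PosSemidef}) :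
    InfPred (ι₁ × ι₂) :=
  InfPred.ofPos (φ₁.1 ⊗ₖ (1 : Matrix ι₂ ι₂ ℂ) + (1 : Matrix ι₁ ι₁ ℂ) ⊗ₖ φ₂.1)
    ((φ₁.2.kronecker Matrix.PosSemidef.one).add (Matrix.PosSemidef.one.kronecker φ₂.2))

/-- The duality set of `φ`: the triples `(n, φ₁, φ₂)` of a natural number and two positive
operators with `φ₁ ⊗ id + id ⊗ φ₂ ⊑ φ + n • id`. -/
def dualitySet (φ : InfPred (ι₁ × ι₂)) :
    Set (ℕ × {P : Matrix ι₁ ι₁ ℂ // P.PosSemidef} × {P : Matrix ι₂ ι₂ ℂ // P.PosSemidef}) :=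
  {y | split y.2.1 y.2.2 ≤ φ + InfPred.natId y.1}

/-- The measurement condition `K₁ ≈ K₂ : ψ ⇒ φ` for two measurements with the same outcomes:
if `ψ` has finite expectation in a joint state, then the post-measurement states can be coupled
for each common outcome `m`, such that the expectation of `ψ` bounds the total
expectation of the predicates `φ m`. -/
def MeasCond {n : ℕ} (K₁ : Fin n → Matrix ι₁ ι₁ ℂ) (K₂ : Fin n → Matrix ι₂ ι₂ ℂ)
    (ψ : InfPred (ι₁ × ι₂)) (φ : Fin n → InfPred (ι₁ × ι₂)) : Prop :=
  ∀ ρ : Matrix (ι₁ × ι₂) (ι₁ × ι₂) ℂ, ρ.PosSemidef → ρ.trace.re ≤ 1 → ψ.expect ρ ≠ ⊤ →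
    ∃ σ : Fin n → Matrix (ι₁ × ι₂) (ι₁ × ι₂) ℂ,
      (∀ m, IsCoupling (σ m) (K₁ m * trace₂ ρ * (K₁ m)ᴴ) (K₂ m * trace₁ ρ * (K₂ m)ᴴ)) ∧
      ∑ m, (φ m).expect (σ m) ≤ ψ.expect ρ

end Couplings

/-! ### The logic -/

section Logic

variable {V₁ V₂ : Type*} [Fintype V₁] [DecidableEq V₁] [Fintype V₂] [DecidableEq V₂]
  {d₁ : V₁ → ℕ} {d₂ : V₂ → ℕ}

/-- Relational assertions: infinite-valued predicates on the joint state space. -/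
abbrev RelAssn (d₁ : V₁ → ℕ) (d₂ : V₂ → ℕ) : Type _ := InfPred (Basis d₁ × Basis d₂)

/-- Validity of `{ψ} c₁ ~ c₂ {φ}`: for every joint density operator there is a partial
coupling of the two outputs in which the expectation of `φ` is at most that of `ψ` in the
input. -/
def Valid (ψ : RelAssn d₁ d₂) (c₁ : Prog d₁) (c₂ : Prog d₂) (φ : RelAssn d₁ d₂) : Prop :=
  ∀ ρ : Matrix (Basis d₁ × Basis d₂) (Basis d₁ × Basis d₂) ℂ, ρ.PosSemidef → ρ.trace = 1 →
    ∃ σ, IsPartialCoupling σ (c₁.sem (trace₂ ρ)) (c₂.sem (trace₁ ρ)) ∧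
      φ.expect σ ≤ ψ.expect ρ

/-- Validity of `{ψ} c₁ ~ c₂ {φ}` with couplings in place of partial couplings: for every
joint partial density operator there is a coupling of the two outputs in which the expectation
of `φ` is at most that of `ψ` in the input. -/
def ValidCoupling (ψ : RelAssn d₁ d₂) (c₁ : Prog d₁) (c₂ : Prog d₂) (φ : RelAssn d₁ d₂) :
    Prop :=
  ∀ ρ : Matrix (Basis d₁ × Basis d₂) (Basis d₁ × Basis d₂) ℂ, ρ.PosSemidef → ρ.trace.re ≤ 1 →
    ∃ σ, IsCoupling σ (c₁.sem (trace₂ ρ)) (c₂.sem (trace₁ ρ)) ∧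
      φ.expect σ ≤ ψ.expect ρ

/-- An operator on the left system, on the joint system. -/
def onL (K : Matrix (Basis d₁) (Basis d₁) ℂ) :
    Matrix (Basis d₁ × Basis d₂) (Basis d₁ × Basis d₂) ℂ :=
  K ⊗ₖ (1 : Matrix (Basis d₂) (Basis d₂) ℂ)

/-- An operator on the right system, on the joint system. -/
def onR (K : Matrix (Basis d₂) (Basis d₂) ℂ) :
    Matrix (Basis d₁ × Basis d₂) (Basis d₁ × Basis d₂) ℂ :=
  (1 : Matrix (Basis d₁) (Basis d₁) ℂ) ⊗ₖ K

/-- Derivability of `{ψ} c₁ ~ c₂ {φ}` in qOTL extended with the rule `unboundedDuality`. -/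
inductive Derivable : RelAssn d₁ d₂ → Prog d₁ → Prog d₂ → RelAssn d₁ d₂ → Prop
  /- two-sided rules -/
  | skip (ψ : RelAssn d₁ d₂) : Derivable ψ .skip .skip ψ
  | init (Q₁ w₁ h₁ Q₂ w₂ h₂) (ψ : RelAssn d₁ d₂) :
      Derivable
        (InfPred.kraus (fun i : RegBasis d₁ Q₁ × RegBasis d₂ Q₂ =>
          initKraus Q₁ w₁ i.1 ⊗ₖ initKraus Q₂ w₂ i.2) fun _ => ψ)
        (.init Q₁ w₁ h₁) (.init Q₂ w₂ h₂) ψ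
  | apply (Q₁ U₁ Q₂ U₂) (ψ : RelAssn d₁ d₂) :
      Derivable (InfPred.kraus (fun _ : Unit => lift Q₁ U₁.1 ⊗ₖ lift Q₂ U₂.1) fun _ => ψ)
        (.apply Q₁ U₁) (.apply Q₂ U₂) ψ
  | seq {ψ ξ φ : RelAssn d₁ d₂} {c₁ c₁' c₂ c₂'} :
      Derivable ψ c₁ c₂ ξ → Derivable ξ c₁' c₂' φ →
      Derivable ψ (.seq c₁ c₁') (.seq c₂ c₂') φ
  | cond {n Q₁ Q₂} {M₁ : Measurement d₁ Q₁ n} {M₂ : Measurement d₂ Q₂ n} {S₁ S₂}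
      {ψ φ : RelAssn d₁ d₂} (ξ : Fin n → RelAssn d₁ d₂) :
      MeasCond M₁.lifted M₂.lifted ψ ξ →
      (∀ m, Derivable (ξ m) (S₁ m) (S₂ m) φ) →
      Derivable ψ (.cond Q₁ n M₁ S₁) (.cond Q₂ n M₂ S₂) φ
  | loop {Q₁ Q₂} {M₁ : Measurement d₁ Q₁ 2} {M₂ : Measurement d₂ Q₂ 2} {c₁ c₂}
      {ψ φ ξ : RelAssn d₁ d₂} :
      MeasCond M₁.lifted M₂.lifted ψ ![φ, ξ] →
      Derivable ξ c₁ c₂ ψ →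
      Derivable ψ (.loop Q₁ M₁ c₁) (.loop Q₂ M₂ c₂) φ
  /- one-sided rules, left -/
  | initL (Q w h) (ψ : RelAssn d₁ d₂) :
      Derivable (InfPred.kraus (fun i : RegBasis d₁ Q => onL (initKraus Q w i)) fun _ => ψ)
        (.init Q w h) .skip ψ
  | applyL (Q U) (ψ : RelAssn d₁ d₂) :
      Derivable (InfPred.kraus (fun _ : Unit => onL (lift Q U.1)) fun _ => ψ)
        (.apply Q U) .skip ψ
  | condL {n Q} {M : Measurement d₁ Q n} {S c₂} {φ : RelAssn d₁ d₂} (ξ : Fin n → RelAssn d₁ d₂) :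
      (∀ m, Derivable (ξ m) (S m) c₂ φ) →
      Derivable (InfPred.kraus (fun m => onL (M.lifted m)) ξ) (.cond Q n M S) c₂ φ
  | loopL {Q} {M : Measurement d₁ Q 2} {c} {φ ξ : RelAssn d₁ d₂} :
      Derivable ξ c .skip (InfPred.kraus (fun m => onL (M.lifted m)) ![φ, ξ]) →
      Derivable (InfPred.kraus (fun m => onL (M.lifted m)) ![φ, ξ]) (.loop Q M c) .skip φ
  /- one-sided rules, right -/
  | initR (Q w h) (ψ : RelAssn d₁ d₂) :
      Derivable (InfPred.kraus (fun i : RegBasis d₂ Q => onR (initKraus Q w i)) fun _ => ψ)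
        .skip (.init Q w h) ψ
  | applyR (Q U) (ψ : RelAssn d₁ d₂) :
      Derivable (InfPred.kraus (fun _ : Unit => onR (lift Q U.1)) fun _ => ψ)
        .skip (.apply Q U) ψ
  | condR {n Q} {M : Measurement d₂ Q n} {S c₁} {φ : RelAssn d₁ d₂} (ξ : Fin n → RelAssn d₁ d₂) :
      (∀ m, Derivable (ξ m) c₁ (S m) φ) →
      Derivable (InfPred.kraus (fun m => onR (M.lifted m)) ξ) c₁ (.cond Q n M S) φ
  | loopR {Q} {M : Measurement d₂ Q 2} {c} {φ ξ : RelAssn d₁ d₂} :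
      Derivable ξ .skip c (InfPred.kraus (fun m => onR (M.lifted m)) ![φ, ξ]) →
      Derivable (InfPred.kraus (fun m => onR (M.lifted m)) ![φ, ξ]) .skip (.loop Q M c) φ
  /- structural rules -/
  | same {ψ φ : RelAssn d₁ d₂} {c₁ c₁' c₂ c₂'} :
      Prog.Same c₁ c₁' → Prog.Same c₂ c₂' → Derivable ψ c₁ c₂ φ → Derivable ψ c₁' c₂' φ
  | conseq {ψ ψ' φ φ' : RelAssn d₁ d₂} {c₁ c₂} :
      ψ' ≤ ψ → Derivable ψ' c₁ c₂ φ' → φ ≤ φ' → Derivable ψ c₁ c₂ φ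
  | boundedDuality {ψ φ : RelAssn d₁ d₂} {c₁ c₂} :
      c₁.AST → c₂.AST → φ.inf = 0 →
      (∀ y ∈ dualitySet φ, Derivable (ψ + InfPred.natId y.1) c₁ c₂ (split y.2.1 y.2.2)) →
      Derivable ψ c₁ c₂ φ
  | unboundedDuality {ψ φ : RelAssn d₁ d₂} {c₁ c₂} :
      c₁.AST → c₂.AST →
      (∀ y ∈ dualitySet φ, Derivable (ψ + InfPred.natId y.1) c₁ c₂ (split y.2.1 y.2.2)) →
      Derivable ψ c₁ c₂ φ

end Logic

end QOTL

end

set_option linter.unusedSectionVars false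

namespace QOTL

/-! ### Positive semidefinite matrices -/

section PosSemidef

variable {ι : Type*} [Fintype ι]

open scoped MatrixOrder in
theorem exists_eq_conjTranspose_mul_self {ρ : Matrix ι ι ℂ} (h : ρ.PosSemidef) :
    ∃ B : Matrix ι ι ℂ, ρ = Bᴴ * B := by
  classical
  exact CStarAlgebra.nonneg_iff_eq_star_mul_self.mp h.nonneg

theorem trace_mul_nonneg {A B : Matrix ι ι ℂ} (hA : A.PosSemidef) (hB : B.PosSemidef) :
    0 ≤ (A * B).trace := by
  obtain ⟨a, rfl⟩ := exists_eq_conjTranspose_mul_self hA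
  have := hB.mul_mul_conjTranspose_same a
  rw [mul_assoc, Matrix.trace_mul_comm]
  exact this.trace_nonneg

theorem trace_mul_re_nonneg {A B : Matrix ι ι ℂ} (hA : A.PosSemidef) (hB : B.PosSemidef) :
    0 ≤ (A * B).trace.re :=
  (Complex.le_def.1 (trace_mul_nonneg hA hB)).1

theorem trace_re_nonneg {A : Matrix ι ι ℂ} (hA : A.PosSemidef) : 0 ≤ A.trace.re :=
  (Complex.le_def.1 hA.trace_nonneg).1

theorem trace_eq_re {A : Matrix ι ι ℂ} (hA : A.PosSemidef) : A.trace = A.trace.re := by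
  have := (Complex.le_def.1 hA.trace_nonneg).2
  exact Complex.ext rfl (by simpa using this.symm)

theorem mul_eq_zero_of_trace_re_eq_zero {A B : Matrix ι ι ℂ} (hA : A.PosSemidef)
    (hB : B.PosSemidef) (h : (A * B).trace.re = 0) : A * B = 0 := by
  have h0 : (A * B).trace = 0 :=
    Complex.ext h (Complex.le_def.1 (trace_mul_nonneg hA hB)).2.symm
  obtain ⟨a, rfl⟩ := exists_eq_conjTranspose_mul_self hA
  obtain ⟨b, rfl⟩ := exists_eq_conjTranspose_mul_self hB
  have h1 : (a * bᴴ) * (a * bᴴ)ᴴ = 0 := by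
    have hp := Matrix.posSemidef_self_mul_conjTranspose (a * bᴴ)
    rw [← hp.trace_eq_zero_iff, ← h0, Matrix.conjTranspose_mul, Matrix.conjTranspose_conjTranspose,
      mul_assoc aᴴ, Matrix.trace_mul_comm aᴴ]
    simp only [mul_assoc]
  have h2 : a * bᴴ = 0 := by
    rwa [Matrix.self_mul_conjTranspose_eq_zero] at h1
  calc aᴴ * a * (bᴴ * b) = aᴴ * (a * bᴴ) * b := by simp only [mul_assoc]
    _ = 0 := by rw [h2]; simp

theorem eq_zero_of_trace_re {A : Matrix ι ι ℂ} (hA : A.PosSemidef) (h : A.trace.re = 0) :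
    A = 0 := by
  rw [← hA.trace_eq_zero_iff, trace_eq_re hA, h, Complex.ofReal_zero]

theorem posSemidef_smul {A : Matrix ι ι ℂ} (hA : A.PosSemidef) {c : ℝ} (hc : 0 ≤ c) :
    ((c : ℂ) • A).PosSemidef :=
  hA.smul (Complex.zero_le_real.2 hc)

theorem trace_ofReal_smul_re (A : Matrix ι ι ℂ) (c : ℝ) :
    ((c : ℂ) • A).trace.re = c * A.trace.re := by
  simp [Matrix.trace_smul]

theorem continuous_trace_re : Continuous fun A : Matrix ι ι ℂ => A.trace.re :=
  Complex.continuous_re.comp continuous_id.matrix_trace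

theorem norm_apply_le_trace_re {A : Matrix ι ι ℂ} (hA : A.PosSemidef) (i j : ι) :
    ‖A i j‖ ≤ A.trace.re := by
  have hd : ∀ k, 0 ≤ (A k k).re := fun k => (Complex.le_def.1 hA.diag_nonneg).1
  have ht : A.trace.re = ∑ k, (A k k).re := by simp [Matrix.trace]
  have hk : ∀ k, (A k k).re ≤ A.trace.re := fun k => by
    rw [ht]; exact Finset.single_le_sum (fun k _ => hd k) (Finset.mem_univ k)
  obtain ⟨B, rfl⟩ := exists_eq_conjTranspose_mul_self hA
  have hdiag : ∀ k, ((Bᴴ * B) k k).re = ∑ l, ‖B l k‖ ^ 2 := fun k => by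
    simp only [Matrix.mul_apply, Matrix.conjTranspose_apply, Complex.re_sum]
    refine Finset.sum_congr rfl fun l _ => ?_
    rw [← Complex.normSq_eq_norm_sq, Complex.normSq_apply]
    simp
  have h1 : ‖(Bᴴ * B) i j‖ ≤ ∑ l, (‖B l i‖ ^ 2 + ‖B l j‖ ^ 2) / 2 := by
    rw [Matrix.mul_apply]
    refine (norm_sum_le _ _).trans (Finset.sum_le_sum fun l _ => ?_)
    rw [norm_mul, Matrix.conjTranspose_apply, norm_star]
    nlinarith [sq_nonneg (‖B l i‖ - ‖B l j‖)]
  have h2 : ∑ l, (‖B l i‖ ^ 2 + ‖B l j‖ ^ 2) / 2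
      = (((Bᴴ * B) i i).re + ((Bᴴ * B) j j).re) / 2 := by
    rw [hdiag, hdiag, ← Finset.sum_add_distrib, Finset.sum_div]
  linarith [hk i, hk j]

theorem isClosed_setOf_posSemidef : IsClosed {A : Matrix ι ι ℂ | A.PosSemidef} := by
  have : {A : Matrix ι ι ℂ | A.PosSemidef} =
      {A | Aᴴ = A} ∩ ⋂ x : ι → ℂ, {A | 0 ≤ star x ⬝ᵥ (A *ᵥ x)} := by
    ext A
    simp [Matrix.posSemidef_iff_dotProduct_mulVec, Matrix.IsHermitian]
  rw [this]
  refine (isClosed_eq continuous_id.matrix_conjTranspose continuous_id).inter (isClosed_iInter fun x => ?_)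
  exact isClosed_le continuous_const (by fun_prop)

theorem isCompact_setOf_posSemidef_trace_le (r : ℝ) :
    IsCompact {A : Matrix ι ι ℂ | A.PosSemidef ∧ A.trace.re ≤ r} := by
  have hc : IsCompact (Set.univ.pi fun _ : ι => Set.univ.pi fun _ : ι =>
      Metric.closedBall (0 : ℂ) r) :=
    isCompact_univ_pi fun _ => isCompact_univ_pi fun _ => isCompact_closedBall _ _
  refine hc.of_isClosed_subset
    (isClosed_setOf_posSemidef.inter (isClosed_le continuous_trace_re continuous_const)) ?_
  rintro A ⟨hA, hr⟩ i - j -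
  simpa using (norm_apply_le_trace_re hA i j).trans hr

theorem posSemidef_of_trace_mul_nonneg {A : Matrix ι ι ℂ} (h : A.IsHermitian)
    (hA : ∀ ρ : Matrix ι ι ℂ, ρ.PosSemidef → 0 ≤ (A * ρ).trace.re) : A.PosSemidef := by
  refine Matrix.PosSemidef.of_dotProduct_mulVec_nonneg h fun x => ?_
  have h1 := hA _ (Matrix.posSemidef_vecMulVec_self_star x)
  have h2 : (A * Matrix.vecMulVec x (star x)).trace = star x ⬝ᵥ (A *ᵥ x) := by
    rw [Matrix.mul_vecMulVec, Matrix.trace_vecMulVec, dotProduct_comm]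
  rw [h2] at h1
  have h3 : star (star x ⬝ᵥ (A *ᵥ x)) = star x ⬝ᵥ (A *ᵥ x) := by
    rw [← Matrix.star_dotProduct_star, star_star, Matrix.star_mulVec, h.eq, dotProduct_comm,
      Matrix.dotProduct_mulVec, dotProduct_comm]
  refine Complex.le_def.2 ⟨h1, ?_⟩
  exact (Complex.conj_eq_iff_im.1 h3).symm

/-- Every matrix is a complex linear combination of four positive semidefinite ones. -/
theorem exists_posSemidef_decomposition [DecidableEq ι] (A : Matrix ι ι ℂ) :
    ∃ P : Fin 4 → Matrix ι ι ℂ, ∃ c : Fin 4 → ℂ, (∀ k, (P k).PosSemidef) ∧ A = ∑ k, c k • P k := by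
  have hsq : ∀ H : Matrix ι ι ℂ, Hᴴ = H → (H * H).PosSemidef := fun H hH => by
    have := Matrix.posSemidef_conjTranspose_mul_self H
    rwa [hH] at this
  set X := A + Aᴴ
  set Y := Complex.I • (Aᴴ - A)
  have hX : Xᴴ = X := by simp [X, add_comm]
  have hY : Yᴴ = Y := by
    ext i j
    simp [Y]
    ring
  have hA : A = (1 / 2 : ℂ) • X + (Complex.I / 2) • Y := by
    ext i j
    simp only [X, Y, Matrix.add_apply, Matrix.smul_apply, Matrix.sub_apply, smul_eq_mul]
    linear_combination (1/2 * (A i j - Aᴴ i j)) * Complex.I_sq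
  refine ⟨![(X + 1) * (X + 1), (X - 1) * (X - 1), (Y + 1) * (Y + 1), (Y - 1) * (Y - 1)],
    ![1 / 8, -(1 / 8), Complex.I / 8, -(Complex.I / 8)], ?_, ?_⟩
  · intro k
    fin_cases k
    all_goals exact hsq _ (by simp [hX, hY])
  · rw [hA]
    simp only [Fin.sum_univ_four, Matrix.cons_val]
    have e : ∀ H : Matrix ι ι ℂ, (H + 1) * (H + 1) = (H - 1) * (H - 1) + (4 : ℂ) • H := by
      intro H
      have : (4 : ℂ) • H = H + H + H + H := by module
      rw [this]
      noncomm_ring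
    rw [e, e]
    module

theorem eq_of_trace_mul_eq [DecidableEq ι] {A B : Matrix ι ι ℂ}
    (h : ∀ ρ : Matrix ι ι ℂ, (A * ρ).trace = (B * ρ).trace) : A = B :=
  Matrix.ext_iff_trace_mul_right.2 h

end PosSemidef


/-! ### Expectations -/

section Expect

variable {ι : Type*} [Fintype ι]

/-- The expectation of the formal predicate `P + ∞ • S`. -/
noncomputable def ev (P S ρ : Matrix ι ι ℂ) : ℝ≥0∞ :=
  ENNReal.ofReal (P * ρ).trace.re + ⊤ * ENNReal.ofReal (S * ρ).trace.re

theorem ev_eq_ite {P S ρ : Matrix ι ι ℂ} [Decidable (S * ρ = 0)]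
    (hS : S.PosSemidef) (hρ : ρ.PosSemidef) :
    ev P S ρ = if S * ρ = 0 then ENNReal.ofReal (P * ρ).trace.re else ⊤ := by
  split_ifs with h
  · simp [ev, h]
  · have : 0 < (S * ρ).trace.re :=
      lt_of_le_of_ne (trace_mul_re_nonneg hS hρ)
        fun h' => h (mul_eq_zero_of_trace_re_eq_zero hS hρ h'.symm)
    simp [ev, ENNReal.top_mul, this]

theorem ev_add {P S ρ σ : Matrix ι ι ℂ} (hP : P.PosSemidef) (hS : S.PosSemidef)
    (hρ : ρ.PosSemidef) (hσ : σ.PosSemidef) : ev P S (ρ + σ) = ev P S ρ + ev P S σ := by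
  simp only [ev, mul_add, Matrix.trace_add, Complex.add_re]
  rw [ENNReal.ofReal_add (trace_mul_re_nonneg hP hρ) (trace_mul_re_nonneg hP hσ),
    ENNReal.ofReal_add (trace_mul_re_nonneg hS hρ) (trace_mul_re_nonneg hS hσ), mul_add]
  abel

theorem ev_smul (P S ρ : Matrix ι ι ℂ) {c : ℝ} (hc : 0 ≤ c) :
    ev P S ((c : ℂ) • ρ) = ENNReal.ofReal c * ev P S ρ := by
  simp only [ev, mul_smul_comm, trace_ofReal_smul_re, ENNReal.ofReal_mul hc]
  ring

@[simp]
theorem ev_zero (P S : Matrix ι ι ℂ) : ev P S 0 = 0 := by simp [ev]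

theorem posSemidef_of_projection {X : Matrix ι ι ℂ} (h : X.IsHermitian) (h' : X * X = X) :
    X.PosSemidef := by
  have := Matrix.posSemidef_conjTranspose_mul_self X
  rwa [h.eq, h'] at this

variable [DecidableEq ι]

theorem suppProj_zero : suppProj (0 : Matrix ι ι ℂ) = 0 := by
  simp [suppProj, cfc_apply_zero]

theorem suppProj_mul_eq_zero_iff {S : Matrix ι ι ℂ} (hS : S.IsHermitian) (ρ : Matrix ι ι ℂ) :
    suppProj S * ρ = 0 ↔ S * ρ = 0 := by
  have hS' : IsSelfAdjoint S := hS
  have hc : ∀ f : ℝ → ℝ, ContinuousOn f (spectrum ℝ S) := fun f =>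
    (Matrix.finite_real_spectrum (A := S)).continuousOn _
  have h1 : S * suppProj S = S := by
    unfold suppProj
    conv_rhs => rw [← cfc_id ℝ S hS']
    conv_lhs => enter [1]; rw [← cfc_id ℝ S hS']
    rw [← cfc_mul _ _ S (hc _) (hc _)]
    congr 1
    ext x
    by_cases hx : x = 0 <;> simp [hx]
  have h2 : cfc (fun x : ℝ => x⁻¹) S * S = suppProj S := by
    unfold suppProj
    conv_lhs => enter [2]; rw [← cfc_id ℝ S hS']
    rw [← cfc_mul _ _ S (hc _) (hc _)]
    congr 1
    ext x
    by_cases hx : x = 0 <;> simp [hx]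
  constructor
  · intro h
    rw [← h1, mul_assoc, h, mul_zero]
  · intro h
    rw [← h2, mul_assoc, h, mul_zero]

namespace InfPred

theorem inf_posSemidef (A : InfPred ι) : A.inf.PosSemidef :=
  posSemidef_of_projection A.inf_isHermitian A.inf_mul_inf

theorem expect_eq_ev (A : InfPred ι) {ρ : Matrix ι ι ℂ} (hρ : ρ.PosSemidef) :
    A.expect ρ = ev A.fin A.inf ρ := by
  classical
  rw [ev_eq_ite A.inf_posSemidef hρ]
  unfold expect
  congr

theorem expect_ofParts {P S : Matrix ι ι ℂ} (hP : P.PosSemidef) (hS : S.PosSemidef)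
    {ρ : Matrix ι ι ℂ} (hρ : ρ.PosSemidef) : (ofParts P S hP).expect ρ = ev P S ρ := by
  classical
  rw [ev_eq_ite hS hρ]
  simp only [← suppProj_mul_eq_zero_iff hS.1]
  unfold expect
  change (if suppProj S * ρ = 0 then
    ENNReal.ofReal ((1 - suppProj S) * P * (1 - suppProj S) * ρ).trace.re else ⊤) = _
  split_ifs with h
  · have h' : ρ * suppProj S = 0 := by
      have := congrArg Matrix.conjTranspose h
      rwa [Matrix.conjTranspose_mul, hρ.1.eq, (suppProj_isHermitian S).eq,
        Matrix.conjTranspose_zero] at this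
    have e1 : (1 - suppProj S) * ρ = ρ := by rw [sub_mul, h, one_mul, sub_zero]
    have e2 : ρ * (1 - suppProj S) = ρ := by rw [mul_sub, h', mul_one, sub_zero]
    rw [mul_assoc, e1, mul_assoc, Matrix.trace_mul_comm, mul_assoc, e2]
  · rfl

theorem expect_ofPos {P : Matrix ι ι ℂ} (hP : P.PosSemidef) (ρ : Matrix ι ι ℂ) :
    (ofPos P hP).expect ρ = ENNReal.ofReal (P * ρ).trace.re := by
  simp [expect, ofPos]

theorem expect_natId (n : ℕ) (ρ : Matrix ι ι ℂ) :
    (natId n).expect ρ = ENNReal.ofReal (n * ρ.trace.re) := by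
  rw [natId, expect_ofPos]
  simp [Matrix.trace_smul]

theorem expect_add_matrix (A : InfPred ι) {ρ σ : Matrix ι ι ℂ} (hρ : ρ.PosSemidef)
    (hσ : σ.PosSemidef) : A.expect (ρ + σ) = A.expect ρ + A.expect σ := by
  rw [A.expect_eq_ev hρ, A.expect_eq_ev hσ, A.expect_eq_ev (hρ.add hσ),
    ev_add A.fin_posSemidef A.inf_posSemidef hρ hσ]

theorem expect_smul (A : InfPred ι) {ρ : Matrix ι ι ℂ} (hρ : ρ.PosSemidef) {c : ℝ}
    (hc : 0 ≤ c) : A.expect ((c : ℂ) • ρ) = ENNReal.ofReal c * A.expect ρ := by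
  rw [A.expect_eq_ev hρ, A.expect_eq_ev (posSemidef_smul hρ hc), ev_smul _ _ _ hc]

@[simp]
theorem expect_zero (A : InfPred ι) : A.expect 0 = 0 := by simp [expect]

theorem expect_sum (A : InfPred ι) {κ : Type*} (s : Finset κ) {ρ : κ → Matrix ι ι ℂ}
    (hρ : ∀ k, (ρ k).PosSemidef) : A.expect (∑ k ∈ s, ρ k) = ∑ k ∈ s, A.expect (ρ k) := by
  classical
  induction s using Finset.induction_on with
  | empty => simp
  | insert a s ha ih =>
    rw [Finset.sum_insert ha, Finset.sum_insert ha, A.expect_add_matrix (hρ a)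
      (Matrix.posSemidef_sum _ fun k _ => hρ k), ih]

theorem expect_add (A B : InfPred ι) {ρ : Matrix ι ι ℂ} (hρ : ρ.PosSemidef) :
    (A + B).expect ρ = A.expect ρ + B.expect ρ := by
  rw [A.expect_eq_ev hρ, B.expect_eq_ev hρ]
  refine (expect_ofParts (A.fin_posSemidef.add B.fin_posSemidef)
    (A.inf_posSemidef.add B.inf_posSemidef) hρ).trans ?_
  simp only [ev, add_mul, Matrix.trace_add, Complex.add_re]
  rw [ENNReal.ofReal_add (trace_mul_re_nonneg A.fin_posSemidef hρ)
      (trace_mul_re_nonneg B.fin_posSemidef hρ),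
    ENNReal.ofReal_add (trace_mul_re_nonneg A.inf_posSemidef hρ)
      (trace_mul_re_nonneg B.inf_posSemidef hρ), mul_add]
  abel

theorem expect_kraus {κ : Type*} [Fintype κ] (K : κ → Matrix ι ι ℂ) (A : κ → InfPred ι)
    {ρ : Matrix ι ι ℂ} (hρ : ρ.PosSemidef) :
    (kraus K A).expect ρ = ∑ k, (A k).expect (K k * ρ * (K k)ᴴ) := by
  have hK : ∀ k, (K k * ρ * (K k)ᴴ).PosSemidef := fun k => hρ.mul_mul_conjTranspose_same _
  refine (expect_ofParts _ (Matrix.posSemidef_sum _ fun k _ =>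
    (A k).inf_posSemidef.conjTranspose_mul_mul_same (K k)) hρ).trans ?_
  have e : ∀ X k, ((K k)ᴴ * X * K k * ρ).trace = (X * (K k * ρ * (K k)ᴴ)).trace := fun X k => by
    rw [mul_assoc, mul_assoc, Matrix.trace_mul_comm, mul_assoc]
  simp only [fun k => (A k).expect_eq_ev (hK k), ev, Finset.sum_mul, Matrix.trace_sum,
    Complex.re_sum, e, Finset.sum_add_distrib]
  rw [ENNReal.ofReal_sum_of_nonneg fun k _ => trace_mul_re_nonneg (A k).fin_posSemidef (hK k),
    ENNReal.ofReal_sum_of_nonneg fun k _ => trace_mul_re_nonneg (A k).inf_posSemidef (hK k),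
    Finset.mul_sum]

theorem exists_eq_sum_vecMulVec {ρ : Matrix ι ι ℂ} (hρ : ρ.PosSemidef) :
    ∃ v : ι → ι → ℂ, ρ = ∑ k, Matrix.vecMulVec (v k) (star (v k)) := by
  obtain ⟨B, rfl⟩ := exists_eq_conjTranspose_mul_self hρ
  refine ⟨fun k i => star (B k i), ?_⟩
  ext i j
  simp [Matrix.mul_apply, Matrix.sum_apply, Matrix.vecMulVec_apply]

theorem expect_mono {A B : InfPred ι} (h : A ≤ B) {ρ : Matrix ι ι ℂ} (hρ : ρ.PosSemidef) :
    A.expect ρ ≤ B.expect ρ := by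
  obtain ⟨v, rfl⟩ := exists_eq_sum_vecMulVec hρ
  have hv := fun k => Matrix.posSemidef_vecMulVec_self_star (v k)
  rw [A.expect_sum _ hv, B.expect_sum _ hv]
  exact Finset.sum_le_sum fun k _ => h (v k)

theorem le_of_expect_le {A B : InfPred ι}
    (h : ∀ ρ : Matrix ι ι ℂ, ρ.PosSemidef → A.expect ρ ≤ B.expect ρ) : A ≤ B :=
  fun v => h _ (Matrix.posSemidef_vecMulVec_self_star v)

theorem isClosed_setOf_expect_le (A : InfPred ι) (t : ℝ≥0∞) :
    IsClosed {σ : Matrix ι ι ℂ | σ.PosSemidef ∧ A.expect σ ≤ t} := by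
  rcases eq_or_ne t ⊤ with rfl | ht
  · simpa using isClosed_setOf_posSemidef
  have : {σ : Matrix ι ι ℂ | σ.PosSemidef ∧ A.expect σ ≤ t} =
      {σ | σ.PosSemidef} ∩ ({σ | A.inf * σ = 0} ∩ {σ | (A.fin * σ).trace.re ≤ t.toReal}) := by
    ext σ
    simp only [expect, Set.mem_ofPred_eq, Set.mem_inter_iff, and_congr_right_iff]
    intro _
    split_ifs with h
    · simp [h, ENNReal.ofReal_le_iff_le_toReal ht]
    · simp [h, ht]
  rw [this]
  refine isClosed_setOf_posSemidef.inter ((isClosed_eq ?_ continuous_const).inter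
    (isClosed_le ?_ continuous_const)) <;> fun_prop

end InfPred

end Expect

/-! ### Partial traces -/

section PartialTrace

variable {ι₁ ι₂ : Type*} [Fintype ι₁] [Fintype ι₂]

theorem isLinearMap_trace₂ :
    IsLinearMap ℂ (trace₂ : Matrix (ι₁ × ι₂) (ι₁ × ι₂) ℂ → Matrix ι₁ ι₁ ℂ) where
  map_add σ τ := by ext; simp [trace₂, Finset.sum_add_distrib]
  map_smul c σ := by ext; simp [trace₂, Finset.mul_sum]

theorem isLinearMap_trace₁ :
    IsLinearMap ℂ (trace₁ : Matrix (ι₁ × ι₂) (ι₁ × ι₂) ℂ → Matrix ι₂ ι₂ ℂ) where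
  map_add σ τ := by ext; simp [trace₁, Finset.sum_add_distrib]
  map_smul c σ := by ext; simp [trace₁, Finset.mul_sum]

theorem posSemidef_trace₂ {σ : Matrix (ι₁ × ι₂) (ι₁ × ι₂) ℂ} (h : σ.PosSemidef) :
    (trace₂ σ).PosSemidef := by
  have : trace₂ σ = ∑ j, σ.submatrix (fun i => (i, j)) (fun i => (i, j)) := by
    ext; simp [trace₂, Matrix.sum_apply]
  rw [this]
  exact Matrix.posSemidef_sum _ fun j _ => h.submatrix _

theorem posSemidef_trace₁ {σ : Matrix (ι₁ × ι₂) (ι₁ × ι₂) ℂ} (h : σ.PosSemidef) :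
    (trace₁ σ).PosSemidef :=
  posSemidef_trace₂ (h.submatrix Prod.swap)

@[simp]
theorem trace_trace₂ (σ : Matrix (ι₁ × ι₂) (ι₁ × ι₂) ℂ) : (trace₂ σ).trace = σ.trace := by
  simp [trace₂, Matrix.trace, Fintype.sum_prod_type]

@[simp]
theorem trace_trace₁ (σ : Matrix (ι₁ × ι₂) (ι₁ × ι₂) ℂ) : (trace₁ σ).trace = σ.trace := by
  simp [trace₁, Matrix.trace, Fintype.sum_prod_type_right]

theorem continuous_trace₂ :
    Continuous (trace₂ : Matrix (ι₁ × ι₂) (ι₁ × ι₂) ℂ → Matrix ι₁ ι₁ ℂ) := by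
  unfold trace₂
  refine continuous_matrix fun i j => ?_
  simp only [Matrix.of_apply]
  fun_prop

theorem continuous_trace₁ :
    Continuous (trace₁ : Matrix (ι₁ × ι₂) (ι₁ × ι₂) ℂ → Matrix ι₂ ι₂ ℂ) := by
  unfold trace₁
  refine continuous_matrix fun i j => ?_
  simp only [Matrix.of_apply]
  fun_prop

variable [DecidableEq ι₁] [DecidableEq ι₂]

theorem trace₂_kronecker (A : Matrix ι₁ ι₁ ℂ) (B : Matrix ι₂ ι₂ ℂ) :
    trace₂ (A ⊗ₖ B) = B.trace • A := by
  ext; simp [trace₂, Matrix.trace, ← Finset.mul_sum, mul_comm]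

theorem trace₁_kronecker (A : Matrix ι₁ ι₁ ℂ) (B : Matrix ι₂ ι₂ ℂ) :
    trace₁ (A ⊗ₖ B) = A.trace • B := by
  ext; simp [trace₁, Matrix.trace, ← Finset.sum_mul]

theorem kronecker_one_mul_apply (K : Matrix ι₁ ι₁ ℂ) (σ : Matrix (ι₁ × ι₂) (ι₁ × ι₂) ℂ)
    (i : ι₁) (j : ι₂) (y : ι₁ × ι₂) :
    (K ⊗ₖ (1 : Matrix ι₂ ι₂ ℂ) * σ) (i, j) y = ∑ k, K i k * σ (k, j) y := by
  simp [Matrix.mul_apply, Fintype.sum_prod_type, Matrix.one_apply]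

theorem mul_kronecker_one_apply (K : Matrix ι₁ ι₁ ℂ) (σ : Matrix (ι₁ × ι₂) (ι₁ × ι₂) ℂ)
    (x : ι₁ × ι₂) (i : ι₁) (j : ι₂) :
    (σ * K ⊗ₖ (1 : Matrix ι₂ ι₂ ℂ)) x (i, j) = ∑ k, σ x (k, j) * K k i := by
  simp [Matrix.mul_apply, Fintype.sum_prod_type, Matrix.one_apply]

theorem one_kronecker_mul_apply (K : Matrix ι₂ ι₂ ℂ) (σ : Matrix (ι₁ × ι₂) (ι₁ × ι₂) ℂ)
    (i : ι₁) (j : ι₂) (y : ι₁ × ι₂) :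
    ((1 : Matrix ι₁ ι₁ ℂ) ⊗ₖ K * σ) (i, j) y = ∑ k, K j k * σ (i, k) y := by
  simp [Matrix.mul_apply, Fintype.sum_prod_type, Matrix.one_apply]

theorem mul_one_kronecker_apply (K : Matrix ι₂ ι₂ ℂ) (σ : Matrix (ι₁ × ι₂) (ι₁ × ι₂) ℂ)
    (x : ι₁ × ι₂) (i : ι₁) (j : ι₂) :
    (σ * (1 : Matrix ι₁ ι₁ ℂ) ⊗ₖ K) x (i, j) = ∑ k, σ x (i, k) * K k j := by
  simp [Matrix.mul_apply, Fintype.sum_prod_type, Matrix.one_apply]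

theorem trace₂_kronecker_one_mul (K : Matrix ι₁ ι₁ ℂ) (σ : Matrix (ι₁ × ι₂) (ι₁ × ι₂) ℂ) :
    trace₂ (K ⊗ₖ (1 : Matrix ι₂ ι₂ ℂ) * σ) = K * trace₂ σ := by
  ext i i'
  simp only [trace₂, Matrix.of_apply, kronecker_one_mul_apply]
  simp only [Matrix.mul_apply, Matrix.of_apply, Finset.mul_sum]
  exact Finset.sum_comm

theorem trace₂_mul_kronecker_one (K : Matrix ι₁ ι₁ ℂ) (σ : Matrix (ι₁ × ι₂) (ι₁ × ι₂) ℂ) :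
    trace₂ (σ * K ⊗ₖ (1 : Matrix ι₂ ι₂ ℂ)) = trace₂ σ * K := by
  ext i i'
  simp only [trace₂, Matrix.of_apply, mul_kronecker_one_apply]
  simp only [Matrix.mul_apply, Matrix.of_apply, Finset.sum_mul]
  exact Finset.sum_comm

theorem trace₁_one_kronecker_mul (K : Matrix ι₂ ι₂ ℂ) (σ : Matrix (ι₁ × ι₂) (ι₁ × ι₂) ℂ) :
    trace₁ ((1 : Matrix ι₁ ι₁ ℂ) ⊗ₖ K * σ) = K * trace₁ σ := by
  ext i i'
  simp only [trace₁, Matrix.of_apply, one_kronecker_mul_apply]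
  simp only [Matrix.mul_apply, Matrix.of_apply, Finset.mul_sum]
  exact Finset.sum_comm

theorem trace₁_mul_one_kronecker (K : Matrix ι₂ ι₂ ℂ) (σ : Matrix (ι₁ × ι₂) (ι₁ × ι₂) ℂ) :
    trace₁ (σ * (1 : Matrix ι₁ ι₁ ℂ) ⊗ₖ K) = trace₁ σ * K := by
  ext i i'
  simp only [trace₁, Matrix.of_apply, mul_one_kronecker_apply]
  simp only [Matrix.mul_apply, Matrix.of_apply, Finset.sum_mul]
  exact Finset.sum_comm

/-- The partial trace is cyclic for operators on the system that is traced out. -/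
theorem trace₂_one_kronecker_mul_comm (K : Matrix ι₂ ι₂ ℂ) (σ : Matrix (ι₁ × ι₂) (ι₁ × ι₂) ℂ) :
    trace₂ ((1 : Matrix ι₁ ι₁ ℂ) ⊗ₖ K * σ) = trace₂ (σ * (1 : Matrix ι₁ ι₁ ℂ) ⊗ₖ K) := by
  ext i i'
  simp only [trace₂, Matrix.of_apply, one_kronecker_mul_apply, mul_one_kronecker_apply]
  rw [Finset.sum_comm]
  simp only [mul_comm]

theorem trace₁_kronecker_one_mul_comm (K : Matrix ι₁ ι₁ ℂ) (σ : Matrix (ι₁ × ι₂) (ι₁ × ι₂) ℂ) :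
    trace₁ (K ⊗ₖ (1 : Matrix ι₂ ι₂ ℂ) * σ) = trace₁ (σ * K ⊗ₖ (1 : Matrix ι₂ ι₂ ℂ)) := by
  ext i i'
  simp only [trace₁, Matrix.of_apply, kronecker_one_mul_apply, mul_kronecker_one_apply]
  rw [Finset.sum_comm]
  simp only [mul_comm]

theorem trace_split_mul (P : Matrix ι₁ ι₁ ℂ) (R : Matrix ι₂ ι₂ ℂ)
    (σ : Matrix (ι₁ × ι₂) (ι₁ × ι₂) ℂ) :
    ((P ⊗ₖ (1 : Matrix ι₂ ι₂ ℂ) + (1 : Matrix ι₁ ι₁ ℂ) ⊗ₖ R) * σ).trace =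
      (P * trace₂ σ).trace + (R * trace₁ σ).trace := by
  rw [add_mul, Matrix.trace_add, ← trace_trace₂, trace₂_kronecker_one_mul,
    ← trace_trace₁ (_ ⊗ₖ R * σ), trace₁_one_kronecker_mul]

theorem expect_split (P : {P : Matrix ι₁ ι₁ ℂ // P.PosSemidef})
    (R : {R : Matrix ι₂ ι₂ ℂ // R.PosSemidef}) (σ : Matrix (ι₁ × ι₂) (ι₁ × ι₂) ℂ) :
    (split P R).expect σ =
      ENNReal.ofReal ((P.1 * trace₂ σ).trace.re + (R.1 * trace₁ σ).trace.re) := by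
  rw [split, InfPred.expect_ofPos, trace_split_mul, Complex.add_re]

end PartialTrace

/-! ### Quantum operations -/

section QOp

variable {ι : Type*} [Fintype ι] [DecidableEq ι]

/-- A linear, positive and trace-nonincreasing map. -/
structure QOp (E : Matrix ι ι ℂ → Matrix ι ι ℂ) : Prop where
  lin : IsLinearMap ℂ E
  psd : ∀ ρ, ρ.PosSemidef → (E ρ).PosSemidef
  trace_le : ∀ ρ, ρ.PosSemidef → (E ρ).trace.re ≤ ρ.trace.re

theorem isLinearMap_map_sum {M N κ : Type*} [AddCommMonoid M] [AddCommMonoid N] [Module ℂ M]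
    [Module ℂ N] {f : M → N} (h : IsLinearMap ℂ f) (s : Finset κ) (x : κ → M) :
    f (∑ k ∈ s, x k) = ∑ k ∈ s, f (x k) :=
  map_sum (IsLinearMap.mk' f h) x s

theorem trace_sum_conj_mul {κ : Type*} [Fintype κ] (K : κ → Matrix ι ι ℂ)
    (hK : ∑ k, (K k)ᴴ * K k = 1) (ρ : Matrix ι ι ℂ) :
    ∑ k, (K k * ρ * (K k)ᴴ).trace = ρ.trace := by
  have : ∀ k, (K k * ρ * (K k)ᴴ).trace = ((K k)ᴴ * K k * ρ).trace := fun k => by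
    rw [Matrix.trace_mul_comm, ← mul_assoc]
  simp only [this]
  rw [← Matrix.trace_sum, ← Finset.sum_mul, hK, one_mul]

theorem QOp.id : QOp (fun ρ : Matrix ι ι ℂ => ρ) :=
  ⟨IsLinearMap.mk (fun _ _ => rfl) fun _ _ => rfl, fun _ h => h, fun _ _ => le_rfl⟩

theorem QOp.zero : QOp (fun _ : Matrix ι ι ℂ => 0) :=
  ⟨IsLinearMap.mk (by simp) (by simp), fun _ _ => Matrix.PosSemidef.zero,
    fun _ h => by simpa using trace_re_nonneg h⟩

theorem QOp.comp {E F : Matrix ι ι ℂ → Matrix ι ι ℂ} (hF : QOp F) (hE : QOp E) :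
    QOp (fun ρ => F (E ρ)) where
  lin := IsLinearMap.mk (fun ρ σ => by rw [hE.lin.map_add, hF.lin.map_add])
    fun c ρ => by rw [hE.lin.map_smul, hF.lin.map_smul]
  psd ρ h := hF.psd _ (hE.psd _ h)
  trace_le ρ h := (hF.trace_le _ (hE.psd _ h)).trans (hE.trace_le _ h)

theorem QOp.branch {κ : Type*} [Fintype κ] {E : κ → Matrix ι ι ℂ → Matrix ι ι ℂ}
    (hE : ∀ k, QOp (E k)) {K : κ → Matrix ι ι ℂ} (hK : ∑ k, (K k)ᴴ * K k = 1) :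
    QOp (fun ρ => ∑ k, E k (K k * ρ * (K k)ᴴ)) where
  lin := IsLinearMap.mk
    (fun ρ σ => by simp only [mul_add, add_mul, (hE _).lin.map_add, Finset.sum_add_distrib])
    fun c ρ => by simp only [mul_smul_comm, smul_mul_assoc, (hE _).lin.map_smul, Finset.smul_sum]
  psd ρ h := Matrix.posSemidef_sum _ fun k _ =>
    (hE k).psd _ (h.mul_mul_conjTranspose_same _)
  trace_le ρ h := by
    rw [← trace_sum_conj_mul K hK ρ, Matrix.trace_sum, Complex.re_sum, Complex.re_sum]
    exact Finset.sum_le_sum fun k _ => (hE k).trace_le _ (h.mul_mul_conjTranspose_same _)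

theorem QOp.map_conjTranspose {E : Matrix ι ι ℂ → Matrix ι ι ℂ} (hE : QOp E)
    (ρ : Matrix ι ι ℂ) : E ρᴴ = (E ρ)ᴴ := by
  obtain ⟨P, c, hP, rfl⟩ := exists_posSemidef_decomposition ρ
  simp only [Matrix.conjTranspose_sum, Matrix.conjTranspose_smul, fun k => (hP k).1.eq,
    isLinearMap_map_sum hE.lin, hE.lin.map_smul, fun k => (hE.psd _ (hP k)).1.eq]

/-- The adjoint of a quantum operation, evaluated in a positive operator. -/
theorem QOp.exists_adjoint {E : Matrix ι ι ℂ → Matrix ι ι ℂ} (hE : QOp E) {P : Matrix ι ι ℂ}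
    (hP : P.PosSemidef) :
    ∃ Q : Matrix ι ι ℂ, Q.PosSemidef ∧ ∀ ρ, (Q * ρ).trace = (P * E ρ).trace := by
  let Q : Matrix ι ι ℂ := Matrix.of fun j i => (P * E (Matrix.single i j 1)).trace
  have hQ : ∀ ρ, (Q * ρ).trace = (P * E ρ).trace := fun ρ => by
    conv_rhs => rw [Matrix.matrix_eq_sum_single ρ]
    have : ∀ i j, Matrix.single i j (ρ i j) = ρ i j • Matrix.single i j (1 : ℂ) := by
      intro i j; simp
    simp only [this, isLinearMap_map_sum hE.lin, hE.lin.map_smul, Finset.mul_sum,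
      Matrix.trace_sum, mul_smul_comm, Matrix.trace_smul]
    rw [Matrix.trace, Finset.sum_comm]
    simp [Q, Matrix.mul_apply, mul_comm]
  refine ⟨Q, posSemidef_of_trace_mul_nonneg ?_ fun ρ hρ => ?_, hQ⟩
  · refine eq_of_trace_mul_eq fun ρ => ?_
    have h1 : (Qᴴ * ρ).trace = star (Q * ρᴴ).trace := by
      rw [← Matrix.trace_conjTranspose, Matrix.conjTranspose_mul, Matrix.conjTranspose_conjTranspose,
        Matrix.trace_mul_comm]
    rw [h1, hQ, hQ, hE.map_conjTranspose, ← Matrix.trace_conjTranspose, Matrix.conjTranspose_mul,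
      Matrix.conjTranspose_conjTranspose, hP.1.eq, Matrix.trace_mul_comm]
  · rw [hQ]
    exact trace_mul_re_nonneg hP (hE.psd _ hρ)

end QOp

/-! ### Loops -/

section Loop

variable {ι : Type*} [Fintype ι] [DecidableEq ι]

/-- The semantics of a loop with measurement operators `K₀`, `K₁` and body `E`. -/
noncomputable def loopSem (K₀ K₁ : Matrix ι ι ℂ) (E : Matrix ι ι ℂ → Matrix ι ι ℂ)
    (ρ : Matrix ι ι ℂ) : Matrix ι ι ℂ :=
  ∑' k : ℕ, K₀ * (fun τ => E (K₁ * τ * K₁ᴴ))^[k] ρ * K₀ᴴ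

/-- The finite approximations of the semantics of a loop. -/
def loopApprox (K₀ K₁ : Matrix ι ι ℂ) (E : Matrix ι ι ℂ → Matrix ι ι ℂ) (n : ℕ)
    (ρ : Matrix ι ι ℂ) : Matrix ι ι ℂ :=
  ∑ k ∈ Finset.range n, K₀ * (fun τ => E (K₁ * τ * K₁ᴴ))^[k] ρ * K₀ᴴ

variable {K₀ K₁ : Matrix ι ι ℂ} {E : Matrix ι ι ℂ → Matrix ι ι ℂ}

theorem loopApprox_zero : loopApprox K₀ K₁ E 0 = fun _ => 0 := by
  ext1; simp [loopApprox]

theorem loopApprox_succ (n : ℕ) : loopApprox K₀ K₁ E (n + 1) = fun ρ =>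
    ∑ m : Fin 2, (![fun ρ => ρ, fun ρ => loopApprox K₀ K₁ E n (E ρ)] :
      Fin 2 → Matrix ι ι ℂ → Matrix ι ι ℂ) m (![K₀, K₁] m * ρ * (![K₀, K₁] m)ᴴ) := by
  ext1 ρ
  rw [loopApprox, Finset.sum_range_succ', add_comm]
  simp [loopApprox]

theorem qop_loopApprox (hE : QOp E) (hK : K₀ᴴ * K₀ + K₁ᴴ * K₁ = 1) (n : ℕ) :
    QOp (loopApprox K₀ K₁ E n) := by
  induction n with
  | zero => rw [loopApprox_zero]; exact QOp.zero
  | succ n ih =>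
    rw [loopApprox_succ]
    refine QOp.branch (fun m => ?_) (by simpa using hK)
    fin_cases m
    · exact QOp.id
    · exact ih.comp hE

theorem iterate_body_linear (hE : QOp E) (k : ℕ) :
    IsLinearMap ℂ (fun ρ => K₀ * (fun τ => E (K₁ * τ * K₁ᴴ))^[k] ρ * K₀ᴴ) := by
  have h : IsLinearMap ℂ (fun τ => E (K₁ * τ * K₁ᴴ))^[k] := by
    induction k with
    | zero => exact IsLinearMap.mk (fun _ _ => rfl) fun _ _ => rfl
    | succ k ih =>
      refine IsLinearMap.mk (fun ρ σ => ?_) fun c ρ => ?_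
      · simp only [Function.iterate_succ_apply, mul_add, add_mul, hE.lin.map_add, ih.map_add]
      · simp only [Function.iterate_succ_apply, mul_smul_comm, smul_mul_assoc, hE.lin.map_smul,
          ih.map_smul]
  exact IsLinearMap.mk (fun ρ σ => by simp only [h.map_add, mul_add, add_mul])
    fun c ρ => by simp only [h.map_smul, mul_smul_comm, smul_mul_assoc]

theorem iterate_body_psd (hE : QOp E) (k : ℕ) {ρ : Matrix ι ι ℂ} (hρ : ρ.PosSemidef) :
    (K₀ * (fun τ => E (K₁ * τ * K₁ᴴ))^[k] ρ * K₀ᴴ).PosSemidef := by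
  refine Matrix.PosSemidef.mul_mul_conjTranspose_same ?_ _
  induction k generalizing ρ with
  | zero => exact hρ
  | succ k ih =>
    rw [Function.iterate_succ_apply]
    exact ih (hE.psd _ (hρ.mul_mul_conjTranspose_same _))

open scoped Matrix.Norms.Elementwise in
theorem summable_loop (hE : QOp E) (hK : K₀ᴴ * K₀ + K₁ᴴ * K₁ = 1) (ρ : Matrix ι ι ℂ) :
    Summable fun k : ℕ => K₀ * (fun τ => E (K₁ * τ * K₁ᴴ))^[k] ρ * K₀ᴴ := by
  have key : ∀ ρ : Matrix ι ι ℂ, ρ.PosSemidef →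
      Summable fun k : ℕ => K₀ * (fun τ => E (K₁ * τ * K₁ᴴ))^[k] ρ * K₀ᴴ := by
    intro ρ hρ
    have hp := fun k => iterate_body_psd (K₀ := K₀) (K₁ := K₁) hE k hρ
    refine Summable.of_norm_bounded (summable_of_sum_range_le (c := ρ.trace.re)
      (fun k => trace_re_nonneg (hp k)) fun n => ?_) fun k => ?_
    · have := (qop_loopApprox hE hK n).trace_le ρ hρ
      rwa [loopApprox, Matrix.trace_sum, Complex.re_sum] at this
    · exact (Matrix.norm_le_iff (trace_re_nonneg (hp k))).2 fun i j =>
        norm_apply_le_trace_re (hp k) i j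
  obtain ⟨P, c, hP, rfl⟩ := exists_posSemidef_decomposition ρ
  have h := summable_sum (s := Finset.univ) fun j _ => (key _ (hP j)).const_smul (c j)
  refine h.congr fun k => ?_
  have hl := iterate_body_linear (K₀ := K₀) (K₁ := K₁) hE k
  exact ((isLinearMap_map_sum hl _ _).trans
    (Finset.sum_congr rfl fun j _ => hl.map_smul _ _)).symm

theorem tendsto_loopApprox (hE : QOp E) (hK : K₀ᴴ * K₀ + K₁ᴴ * K₁ = 1) (ρ : Matrix ι ι ℂ) :
    Filter.Tendsto (fun n => loopApprox K₀ K₁ E n ρ) Filter.atTop (nhds (loopSem K₀ K₁ E ρ)) :=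
  (summable_loop hE hK ρ).hasSum.tendsto_sum_nat

theorem qop_loopSem (hE : QOp E) (hK : K₀ᴴ * K₀ + K₁ᴴ * K₁ = 1) : QOp (loopSem K₀ K₁ E) where
  lin := IsLinearMap.mk
    (fun ρ σ => by
      simp only [loopSem, fun k => (iterate_body_linear (K₀ := K₀) (K₁ := K₁) hE k).map_add]
      exact (summable_loop hE hK ρ).tsum_add (summable_loop hE hK σ))
    fun c ρ => by
      simp only [loopSem, fun k => (iterate_body_linear (K₀ := K₀) (K₁ := K₁) hE k).map_smul]
      exact (summable_loop hE hK ρ).tsum_const_smul c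
  psd ρ hρ := isClosed_setOf_posSemidef.mem_of_tendsto (tendsto_loopApprox hE hK ρ)
    (Filter.Eventually.of_forall fun n => (qop_loopApprox hE hK n).psd ρ hρ)
  trace_le ρ hρ := le_of_tendsto
    ((continuous_trace_re.tendsto _).comp
      (tendsto_loopApprox hE hK ρ))
    (Filter.Eventually.of_forall fun n => (qop_loopApprox hE hK n).trace_le ρ hρ)

theorem loopSem_eq (hE : QOp E) (hK : K₀ᴴ * K₀ + K₁ᴴ * K₁ = 1) (ρ : Matrix ι ι ℂ) :
    loopSem K₀ K₁ E ρ = K₀ * ρ * K₀ᴴ + loopSem K₀ K₁ E (E (K₁ * ρ * K₁ᴴ)) := by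
  rw [loopSem, (summable_loop hE hK ρ).tsum_eq_zero_add]
  rfl

end Loop

/-! ### The semantics of programs -/

section Sem

variable {V : Type*} [Fintype V] [DecidableEq V] {d : V → ℕ}

theorem lift_eq_submatrix (Q : Finset V) (A : Matrix (RegBasis d Q) (RegBasis d Q) ℂ) :
    lift Q A = (A ⊗ₖ (1 : Matrix (∀ v : {v // v ∉ Q}, Fin (d v)) _ ℂ)).submatrix
      (Equiv.piEquivPiSubtypeProd (· ∈ Q) fun v => Fin (d v))
      (Equiv.piEquivPiSubtypeProd (· ∈ Q) fun v => Fin (d v)) := by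
  ext x y
  simp [lift, Matrix.one_apply, funext_iff, Equiv.piEquivPiSubtypeProd]

theorem lift_mul (Q : Finset V) (A B : Matrix (RegBasis d Q) (RegBasis d Q) ℂ) :
    lift Q (A * B) = lift Q A * lift Q B := by
  simp only [lift_eq_submatrix, Matrix.submatrix_mul_equiv, ← Matrix.mul_kronecker_mul, mul_one]

theorem lift_conjTranspose (Q : Finset V) (A : Matrix (RegBasis d Q) (RegBasis d Q) ℂ) :
    (lift Q A)ᴴ = lift Q Aᴴ := by
  simp only [lift_eq_submatrix, Matrix.conjTranspose_submatrix, Matrix.conjTranspose_kronecker,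
    Matrix.conjTranspose_one]

theorem lift_one (Q : Finset V) :
    lift Q (1 : Matrix (RegBasis d Q) (RegBasis d Q) ℂ) = 1 := by
  simp [lift_eq_submatrix]

theorem lift_sum (Q : Finset V) {κ : Type*} (s : Finset κ)
    (A : κ → Matrix (RegBasis d Q) (RegBasis d Q) ℂ) :
    lift Q (∑ k ∈ s, A k) = ∑ k ∈ s, lift Q (A k) := by
  ext x y
  simp only [lift, Matrix.of_apply, Matrix.sum_apply]
  split_ifs <;> simp

theorem Measurement.sum_lifted {Q : Finset V} {n : ℕ} (M : Measurement d Q n) :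
    ∑ m, (M.lifted m)ᴴ * M.lifted m = 1 := by
  simp only [Measurement.lifted, lift_conjTranspose, ← lift_mul, ← lift_sum, M.complete, lift_one]

theorem Measurement.lifted_add {Q : Finset V} (M : Measurement d Q 2) :
    (M.lifted 0)ᴴ * M.lifted 0 + (M.lifted 1)ᴴ * M.lifted 1 = 1 := by
  rw [← M.sum_lifted, Fin.sum_univ_two]

theorem sum_initKraus {Q : Finset V} {w : RegBasis d Q → ℂ} (hw : ∑ i, ‖w i‖ ^ 2 = 1) :
    ∑ i, (initKraus Q w i)ᴴ * initKraus Q w i = 1 := by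
  simp only [initKraus, lift_conjTranspose, ← lift_mul, ← lift_sum]
  rw [← lift_one Q]
  congr 1
  have h : star w ⬝ᵥ w = 1 := by
    simp only [dotProduct, Pi.star_apply]
    rw [← Complex.ofReal_one, ← hw, Complex.ofReal_sum]
    refine Finset.sum_congr rfl fun i _ => ?_
    rw [← Complex.normSq_eq_norm_sq, Complex.normSq_eq_conj_mul_self]
    rfl
  simp only [Matrix.conjTranspose_vecMulVec, Matrix.vecMulVec_mul_vecMulVec, h, one_smul]
  ext i j
  simp [Matrix.sum_apply, Matrix.vecMulVec_apply, Matrix.one_apply, Pi.single_apply]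

theorem lift_unitary (Q : Finset V) (U : Matrix.unitaryGroup (RegBasis d Q) ℂ) :
    (lift Q U.1)ᴴ * lift Q U.1 = 1 := by
  rw [lift_conjTranspose, ← lift_mul, ← Matrix.star_eq_conjTranspose,
    Matrix.mem_unitaryGroup_iff'.1 U.2, lift_one]

namespace Prog

theorem qop_sem (c : Prog d) : QOp c.sem := by
  induction c with
  | skip => exact QOp.id
  | init Q w hw => exact QOp.branch (fun _ => QOp.id) (sum_initKraus hw)
  | apply Q U =>
    have := QOp.branch (κ := Unit) (fun _ => QOp.id (ι := Basis d)) (K := fun _ => lift Q U.1)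
      (by simpa using lift_unitary Q U)
    simp only [Finset.univ_unique, Finset.sum_singleton] at this
    exact this
  | seq c c' h h' => exact h'.comp h
  | cond Q n M S h => exact QOp.branch h M.sum_lifted
  | loop Q M c h => exact qop_loopSem h M.lifted_add

theorem Same.sem_eq {c c' : Prog d} (h : Same c c') : c.sem = c'.sem := by
  induction h with
  | refl c => rfl
  | symm _ ih => exact ih.symm
  | trans _ _ ih ih' => exact ih.trans ih'
  | skip_seq c => rfl
  | seq_skip c => rfl
  | assoc c c' c'' => rfl
  | seq_congr _ _ ih ih' => ext1; simp only [sem, ih, ih']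
  | cond_congr Q n M _ ih => ext1; simp only [sem, ih]
  | loop_congr Q M _ ih => ext1; simp only [sem, ih]

end Prog

end Sem

/-! ### Partial couplings of unnormalized states -/

section PartialCoupling

variable {ι₁ ι₂ : Type*} [Fintype ι₁] [Fintype ι₂] [DecidableEq ι₁] [DecidableEq ι₂]

/-- `σ` is a partial coupling of `ρ₁` and `ρ₂`, relative to states of trace `t`. -/
structure IsScaledCoupling (σ : Matrix (ι₁ × ι₂) (ι₁ × ι₂) ℂ)
    (ρ₁ : Matrix ι₁ ι₁ ℂ) (ρ₂ : Matrix ι₂ ι₂ ℂ) (t : ℝ) : Prop where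
  posSemidef : σ.PosSemidef
  trace₂_le : (ρ₁ - trace₂ σ).PosSemidef
  trace₁_le : (ρ₂ - trace₁ σ).PosSemidef
  trace_le : ρ₁.trace.re + ρ₂.trace.re ≤ t + σ.trace.re

theorem isScaledCoupling_one_iff {σ : Matrix (ι₁ × ι₂) (ι₁ × ι₂) ℂ}
    {ρ₁ : Matrix ι₁ ι₁ ℂ} {ρ₂ : Matrix ι₂ ι₂ ℂ} :
    IsScaledCoupling σ ρ₁ ρ₂ 1 ↔ IsPartialCoupling σ ρ₁ ρ₂ :=
  ⟨fun h => ⟨h.1, h.2, h.3, h.4⟩, fun h => ⟨h.1, h.2, h.3, h.4⟩⟩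

namespace IsScaledCoupling

variable {σ τ : Matrix (ι₁ × ι₂) (ι₁ × ι₂) ℂ} {ρ₁ : Matrix ι₁ ι₁ ℂ} {ρ₂ : Matrix ι₂ ι₂ ℂ} {t : ℝ}

theorem of_isCoupling (h : IsCoupling σ ρ₁ ρ₂) : IsScaledCoupling σ ρ₁ ρ₂ σ.trace.re where
  posSemidef := h.1
  trace₂_le := by rw [h.2, sub_self]; exact Matrix.PosSemidef.zero
  trace₁_le := by rw [h.3, sub_self]; exact Matrix.PosSemidef.zero
  trace_le := by rw [← h.2, ← h.3, trace_trace₂, trace_trace₁]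

theorem trace_le_left (h : IsScaledCoupling σ ρ₁ ρ₂ t) : σ.trace.re ≤ ρ₁.trace.re := by
  have := trace_re_nonneg h.trace₂_le
  rw [Matrix.trace_sub, Complex.sub_re, trace_trace₂] at this
  linarith

/-- States that lose no trace are coupled exactly. -/
theorem isCoupling (h : IsScaledCoupling σ ρ₁ ρ₂ t) (h₁ : ρ₁.trace.re = t)
    (h₂ : ρ₂.trace.re = t) : IsCoupling σ ρ₁ ρ₂ := by
  have h3 := h.trace_le_left
  have h4 := h.trace_le
  refine ⟨h.1, (sub_eq_zero.1 (eq_zero_of_trace_re h.trace₂_le ?_)).symm,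
    (sub_eq_zero.1 (eq_zero_of_trace_re h.trace₁_le ?_)).symm⟩
  · rw [Matrix.trace_sub, Complex.sub_re, trace_trace₂]; linarith
  · rw [Matrix.trace_sub, Complex.sub_re, trace_trace₁]; linarith

theorem sum {κ : Type*} [Fintype κ] {σ : κ → Matrix (ι₁ × ι₂) (ι₁ × ι₂) ℂ}
    {ρ₁ : κ → Matrix ι₁ ι₁ ℂ} {ρ₂ : κ → Matrix ι₂ ι₂ ℂ} {t : κ → ℝ}
    (h : ∀ k, IsScaledCoupling (σ k) (ρ₁ k) (ρ₂ k) (t k)) :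
    IsScaledCoupling (∑ k, σ k) (∑ k, ρ₁ k) (∑ k, ρ₂ k) (∑ k, t k) where
  posSemidef := Matrix.posSemidef_sum _ fun k _ => (h k).1
  trace₂_le := by
    rw [isLinearMap_map_sum isLinearMap_trace₂, ← Finset.sum_sub_distrib]
    exact Matrix.posSemidef_sum _ fun k _ => (h k).2
  trace₁_le := by
    rw [isLinearMap_map_sum isLinearMap_trace₁, ← Finset.sum_sub_distrib]
    exact Matrix.posSemidef_sum _ fun k _ => (h k).3
  trace_le := by
    simp only [Matrix.trace_sum, Complex.re_sum, ← Finset.sum_add_distrib]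
    exact Finset.sum_le_sum fun k _ => (h k).4

theorem smul (h : IsScaledCoupling σ ρ₁ ρ₂ t) {c : ℝ} (hc : 0 ≤ c) :
    IsScaledCoupling ((c : ℂ) • σ) ((c : ℂ) • ρ₁) ((c : ℂ) • ρ₂) (c * t) where
  posSemidef := posSemidef_smul h.1 hc
  trace₂_le := by
    rw [isLinearMap_trace₂.map_smul, ← smul_sub]; exact posSemidef_smul h.2 hc
  trace₁_le := by
    rw [isLinearMap_trace₁.map_smul, ← smul_sub]; exact posSemidef_smul h.3 hc
  trace_le := by
    simp only [trace_ofReal_smul_re, ← mul_add]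
    exact mul_le_mul_of_nonneg_left h.4 hc

theorem kronecker (h₁ : ρ₁.PosSemidef) (h₂ : ρ₂.PosSemidef) (t₁ : ρ₁.trace.re ≤ 1)
    (t₂ : ρ₂.trace.re ≤ 1) : IsScaledCoupling (ρ₁ ⊗ₖ ρ₂) ρ₁ ρ₂ 1 where
  posSemidef := h₁.kronecker h₂
  trace₂_le := by
    have : ρ₁ - trace₂ (ρ₁ ⊗ₖ ρ₂) = ((1 - ρ₂.trace.re : ℝ) : ℂ) • ρ₁ := by
      rw [trace₂_kronecker, Complex.ofReal_sub, ← trace_eq_re h₂, sub_smul, Complex.ofReal_one,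
        one_smul]
    rw [this]
    exact posSemidef_smul h₁ (by linarith)
  trace₁_le := by
    have : ρ₂ - trace₁ (ρ₁ ⊗ₖ ρ₂) = ((1 - ρ₁.trace.re : ℝ) : ℂ) • ρ₂ := by
      rw [trace₁_kronecker, Complex.ofReal_sub, ← trace_eq_re h₁, sub_smul, Complex.ofReal_one,
        one_smul]
    rw [this]
    exact posSemidef_smul h₂ (by linarith)
  trace_le := by
    rw [Matrix.trace_kronecker, trace_eq_re h₁, trace_eq_re h₂, ← Complex.ofReal_mul]
    simp only [Complex.ofReal_re]
    nlinarith

theorem comp (h : IsScaledCoupling σ ρ₁ ρ₂ t) {E₁ : Matrix ι₁ ι₁ ℂ → Matrix ι₁ ι₁ ℂ}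
    {E₂ : Matrix ι₂ ι₂ ℂ → Matrix ι₂ ι₂ ℂ} (hE₁ : QOp E₁) (hE₂ : QOp E₂)
    (hτ : IsScaledCoupling τ (E₁ (trace₂ σ)) (E₂ (trace₁ σ)) σ.trace.re) :
    IsScaledCoupling τ (E₁ ρ₁) (E₂ ρ₂) t := by
  have e₁ : E₁ ρ₁ = E₁ (ρ₁ - trace₂ σ) + E₁ (trace₂ σ) := by
    rw [← hE₁.lin.map_add, sub_add_cancel]
  have e₂ : E₂ ρ₂ = E₂ (ρ₂ - trace₁ σ) + E₂ (trace₁ σ) := by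
    rw [← hE₂.lin.map_add, sub_add_cancel]
  refine ⟨hτ.1, ?_, ?_, ?_⟩
  · rw [e₁, add_sub_assoc]; exact (hE₁.psd _ h.2).add hτ.2
  · rw [e₂, add_sub_assoc]; exact (hE₂.psd _ h.3).add hτ.3
  · have a₁ := hE₁.trace_le _ h.2
    have a₂ := hE₂.trace_le _ h.3
    rw [Matrix.trace_sub, Complex.sub_re, trace_trace₂] at a₁
    rw [Matrix.trace_sub, Complex.sub_re, trace_trace₁] at a₂
    rw [e₁, e₂, Matrix.trace_add, Matrix.trace_add, Complex.add_re, Complex.add_re]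
    linarith [h.4, hτ.4]

end IsScaledCoupling

end PartialCoupling

/-! ### Validity for quantum operations -/

section ValidMap

variable {ι₁ ι₂ : Type*} [Fintype ι₁] [Fintype ι₂] [DecidableEq ι₁] [DecidableEq ι₂]
  {ψ ξ φ : InfPred (ι₁ × ι₂)} {E₁ : Matrix ι₁ ι₁ ℂ → Matrix ι₁ ι₁ ℂ}
  {E₂ : Matrix ι₂ ι₂ ℂ → Matrix ι₂ ι₂ ℂ}

/-- Validity of `{ψ} E₁ ~ E₂ {φ}` for quantum operations, on joint states of any trace. -/
def ValidMap (ψ : InfPred (ι₁ × ι₂)) (E₁ : Matrix ι₁ ι₁ ℂ → Matrix ι₁ ι₁ ℂ)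
    (E₂ : Matrix ι₂ ι₂ ℂ → Matrix ι₂ ι₂ ℂ) (φ : InfPred (ι₁ × ι₂)) : Prop :=
  ∀ ρ : Matrix (ι₁ × ι₂) (ι₁ × ι₂) ℂ, ρ.PosSemidef →
    ∃ σ, IsScaledCoupling σ (E₁ (trace₂ ρ)) (E₂ (trace₁ ρ)) ρ.trace.re ∧
      φ.expect σ ≤ ψ.expect ρ

/-- Every positive operator is zero or a positive multiple of a density operator. -/
theorem exists_eq_smul_density {ι : Type*} [Fintype ι] {ρ : Matrix ι ι ℂ} (hρ : ρ.PosSemidef) :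
    ρ = 0 ∨ 0 < ρ.trace.re ∧ ∃ ρ' : Matrix ι ι ℂ, ρ'.PosSemidef ∧ ρ'.trace = 1 ∧
      ρ = (ρ.trace.re : ℂ) • ρ' := by
  rcases (trace_re_nonneg hρ).eq_or_lt with h | h
  · exact Or.inl (eq_zero_of_trace_re hρ h.symm)
  · have hne : (ρ.trace.re : ℂ) ≠ 0 := by exact_mod_cast h.ne'
    refine Or.inr ⟨h, ((ρ.trace.re)⁻¹ : ℝ) • ρ, ?_, ?_, ?_⟩
    · have := posSemidef_smul hρ (inv_nonneg.2 h.le)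
      rwa [Complex.coe_smul] at this
    · rw [Matrix.trace_smul, Complex.real_smul, Complex.ofReal_inv, ← inv_mul_cancel₀ hne,
        ← trace_eq_re hρ]
    · rw [← Complex.coe_smul, smul_smul, Complex.ofReal_inv, mul_inv_cancel₀ hne, one_smul]

theorem ValidMap.of_density (hE₁ : QOp E₁) (hE₂ : QOp E₂)
    (h : ∀ ρ : Matrix (ι₁ × ι₂) (ι₁ × ι₂) ℂ, ρ.PosSemidef → ρ.trace = 1 → ψ.expect ρ ≠ ⊤ →
      ∃ σ, IsScaledCoupling σ (E₁ (trace₂ ρ)) (E₂ (trace₁ ρ)) 1 ∧ φ.expect σ ≤ ψ.expect ρ) :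
    ValidMap ψ E₁ E₂ φ := by
  intro ρ hρ
  rcases exists_eq_smul_density hρ with rfl | ⟨ht, ρ', hρ', ht', he⟩
  · refine ⟨0, ?_, by simp⟩
    simp only [isLinearMap_trace₂.map_zero, isLinearMap_trace₁.map_zero, hE₁.lin.map_zero,
      hE₂.lin.map_zero]
    exact ⟨.zero, by simp [isLinearMap_trace₂.map_zero, Matrix.PosSemidef.zero],
      by simp [isLinearMap_trace₁.map_zero, Matrix.PosSemidef.zero], by simp⟩
  · have key : ∃ σ, IsScaledCoupling σ (E₁ (trace₂ ρ')) (E₂ (trace₁ ρ')) 1 ∧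
        φ.expect σ ≤ ψ.expect ρ' := by
      by_cases hψ : ψ.expect ρ' = ⊤
      · refine ⟨_, IsScaledCoupling.kronecker (hE₁.psd _ (posSemidef_trace₂ hρ'))
          (hE₂.psd _ (posSemidef_trace₁ hρ')) ?_ ?_, by simp [hψ]⟩
        · exact (hE₁.trace_le _ (posSemidef_trace₂ hρ')).trans (by simp [ht'])
        · exact (hE₂.trace_le _ (posSemidef_trace₁ hρ')).trans (by simp [ht'])
      · exact h ρ' hρ' ht' hψ
    obtain ⟨σ, hσ, hle⟩ := key
    have := hσ.smul ht.le
    refine ⟨((ρ.trace.re : ℝ) : ℂ) • σ, ?_, ?_⟩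
    · rw [mul_one, ← hE₁.lin.map_smul, ← hE₂.lin.map_smul, ← isLinearMap_trace₂.map_smul,
        ← isLinearMap_trace₁.map_smul, ← he] at this
      exact this
    · rw [φ.expect_smul hσ.1 ht.le]
      conv_rhs => rw [he]
      rw [ψ.expect_smul hρ' ht.le]
      gcongr

theorem ValidMap.conseq {ψ' φ' : InfPred (ι₁ × ι₂)} (hψ : ψ' ≤ ψ) (h : ValidMap ψ' E₁ E₂ φ')
    (hφ : φ ≤ φ') : ValidMap ψ E₁ E₂ φ := fun ρ hρ => by
  obtain ⟨σ, hσ, hle⟩ := h ρ hρ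
  exact ⟨σ, hσ, ((InfPred.expect_mono hφ hσ.1).trans hle).trans (InfPred.expect_mono hψ hρ)⟩

theorem ValidMap.id (ψ : InfPred (ι₁ × ι₂)) : ValidMap ψ (fun ρ => ρ) (fun ρ => ρ) ψ :=
  fun ρ hρ => ⟨ρ, .of_isCoupling ⟨hρ, rfl, rfl⟩, le_rfl⟩

theorem ValidMap.comp {F₁ : Matrix ι₁ ι₁ ℂ → Matrix ι₁ ι₁ ℂ} {F₂ : Matrix ι₂ ι₂ ℂ → Matrix ι₂ ι₂ ℂ}
    (hF₁ : QOp F₁) (hF₂ : QOp F₂) (h : ValidMap ψ E₁ E₂ ξ) (h' : ValidMap ξ F₁ F₂ φ) :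
    ValidMap ψ (fun ρ => F₁ (E₁ ρ)) (fun ρ => F₂ (E₂ ρ)) φ := fun ρ hρ => by
  obtain ⟨σ, hσ, hle⟩ := h ρ hρ
  obtain ⟨τ, hτ, hle'⟩ := h' σ hσ.1
  exact ⟨τ, hσ.comp hF₁ hF₂ hτ, hle'.trans hle⟩

theorem ValidMap.branch {n : ℕ} {K₁ : Fin n → Matrix ι₁ ι₁ ℂ} {K₂ : Fin n → Matrix ι₂ ι₂ ℂ}
    (hK₁ : ∑ m, (K₁ m)ᴴ * K₁ m = 1) (hK₂ : ∑ m, (K₂ m)ᴴ * K₂ m = 1)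
    {S₁ : Fin n → Matrix ι₁ ι₁ ℂ → Matrix ι₁ ι₁ ℂ} {S₂ : Fin n → Matrix ι₂ ι₂ ℂ → Matrix ι₂ ι₂ ℂ}
    (hS₁ : ∀ m, QOp (S₁ m)) (hS₂ : ∀ m, QOp (S₂ m)) {ξ : Fin n → InfPred (ι₁ × ι₂)}
    (hM : MeasCond K₁ K₂ ψ ξ) (h : ∀ m, ValidMap (ξ m) (S₁ m) (S₂ m) φ) :
    ValidMap ψ (fun ρ => ∑ m, S₁ m (K₁ m * ρ * (K₁ m)ᴴ))
      (fun ρ => ∑ m, S₂ m (K₂ m * ρ * (K₂ m)ᴴ)) φ := by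
  refine .of_density (.branch hS₁ hK₁) (.branch hS₂ hK₂) fun ρ hρ ht hψ => ?_
  obtain ⟨σ, hσ, hle⟩ := hM ρ hρ (by simp [ht]) hψ
  choose τ hτ hle' using fun m => h m (σ m) (hσ m).1
  refine ⟨∑ m, τ m, ?_, ?_⟩
  · have := IsScaledCoupling.sum hτ
    simp only [fun m => (hσ m).2, fun m => (hσ m).3] at this
    have e : ∑ m, (σ m).trace.re = 1 := by
      have h2 : ∀ m, (σ m).trace = (K₁ m * trace₂ ρ * (K₁ m)ᴴ).trace := fun m => by
        rw [← (hσ m).2, trace_trace₂]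
      rw [← Complex.re_sum]
      simp only [h2, trace_sum_conj_mul K₁ hK₁, trace_trace₂, ht, Complex.one_re]
    rwa [e] at this
  · rw [φ.expect_sum _ fun m => (hτ m).1]
    exact (Finset.sum_le_sum fun m _ => hle' m).trans hle

theorem trace₂_conj_kronecker_one (K : Matrix ι₁ ι₁ ℂ) (ρ : Matrix (ι₁ × ι₂) (ι₁ × ι₂) ℂ) :
    trace₂ (K ⊗ₖ (1 : Matrix ι₂ ι₂ ℂ) * ρ * (K ⊗ₖ (1 : Matrix ι₂ ι₂ ℂ))ᴴ) =
      K * trace₂ ρ * Kᴴ := by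
  rw [Matrix.conjTranspose_kronecker, Matrix.conjTranspose_one, trace₂_mul_kronecker_one,
    trace₂_kronecker_one_mul]

theorem trace₁_conj_one_kronecker (K : Matrix ι₂ ι₂ ℂ) (ρ : Matrix (ι₁ × ι₂) (ι₁ × ι₂) ℂ) :
    trace₁ ((1 : Matrix ι₁ ι₁ ℂ) ⊗ₖ K * ρ * ((1 : Matrix ι₁ ι₁ ℂ) ⊗ₖ K)ᴴ) =
      K * trace₁ ρ * Kᴴ := by
  rw [Matrix.conjTranspose_kronecker, Matrix.conjTranspose_one, trace₁_mul_one_kronecker,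
    trace₁_one_kronecker_mul]

theorem sum_trace₁_conj_kronecker_one {κ : Type*} [Fintype κ] {K : κ → Matrix ι₁ ι₁ ℂ}
    (hK : ∑ m, (K m)ᴴ * K m = 1) (ρ : Matrix (ι₁ × ι₂) (ι₁ × ι₂) ℂ) :
    ∑ m, trace₁ (K m ⊗ₖ (1 : Matrix ι₂ ι₂ ℂ) * ρ * (K m ⊗ₖ (1 : Matrix ι₂ ι₂ ℂ))ᴴ) =
      trace₁ ρ := by
  have e : ∀ m, trace₁ (K m ⊗ₖ (1 : Matrix ι₂ ι₂ ℂ) * ρ * (K m ⊗ₖ (1 : Matrix ι₂ ι₂ ℂ))ᴴ) =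
      trace₁ (((K m)ᴴ * K m) ⊗ₖ (1 : Matrix ι₂ ι₂ ℂ) * ρ) := fun m => by
    rw [Matrix.conjTranspose_kronecker, Matrix.conjTranspose_one, ← trace₁_kronecker_one_mul_comm,
      ← mul_assoc, ← Matrix.mul_kronecker_mul, mul_one]
  have e' : ∑ m, ((K m)ᴴ * K m) ⊗ₖ (1 : Matrix ι₂ ι₂ ℂ) =
      (∑ m, (K m)ᴴ * K m) ⊗ₖ (1 : Matrix ι₂ ι₂ ℂ) := by
    ext; simp [Matrix.sum_apply, Finset.sum_mul]
  simp only [e]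
  rw [← isLinearMap_map_sum isLinearMap_trace₁, ← Finset.sum_mul, e', hK, Matrix.one_kronecker_one,
    one_mul]

theorem sum_trace₂_conj_one_kronecker {κ : Type*} [Fintype κ] {K : κ → Matrix ι₂ ι₂ ℂ}
    (hK : ∑ m, (K m)ᴴ * K m = 1) (ρ : Matrix (ι₁ × ι₂) (ι₁ × ι₂) ℂ) :
    ∑ m, trace₂ ((1 : Matrix ι₁ ι₁ ℂ) ⊗ₖ K m * ρ * ((1 : Matrix ι₁ ι₁ ℂ) ⊗ₖ K m)ᴴ) =
      trace₂ ρ := by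
  have e : ∀ m, trace₂ ((1 : Matrix ι₁ ι₁ ℂ) ⊗ₖ K m * ρ * ((1 : Matrix ι₁ ι₁ ℂ) ⊗ₖ K m)ᴴ) =
      trace₂ ((1 : Matrix ι₁ ι₁ ℂ) ⊗ₖ ((K m)ᴴ * K m) * ρ) := fun m => by
    rw [Matrix.conjTranspose_kronecker, Matrix.conjTranspose_one, ← trace₂_one_kronecker_mul_comm,
      ← mul_assoc, ← Matrix.mul_kronecker_mul, mul_one]
  have e' : ∑ m, (1 : Matrix ι₁ ι₁ ℂ) ⊗ₖ ((K m)ᴴ * K m) =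
      (1 : Matrix ι₁ ι₁ ℂ) ⊗ₖ (∑ m, (K m)ᴴ * K m) := by
    ext; simp [Matrix.sum_apply, Finset.mul_sum]
  simp only [e]
  rw [← isLinearMap_map_sum isLinearMap_trace₂, ← Finset.sum_mul, e', hK, Matrix.one_kronecker_one,
    one_mul]

theorem ValidMap.branchL {κ : Type*} [Fintype κ] {K : κ → Matrix ι₁ ι₁ ℂ}
    (hK : ∑ m, (K m)ᴴ * K m = 1) {S : κ → Matrix ι₁ ι₁ ℂ → Matrix ι₁ ι₁ ℂ}
    {ξ : κ → InfPred (ι₁ × ι₂)} (hE₂ : QOp E₂) (h : ∀ m, ValidMap (ξ m) (S m) E₂ φ) :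
    ValidMap (InfPred.kraus (fun m => K m ⊗ₖ (1 : Matrix ι₂ ι₂ ℂ)) ξ)
      (fun ρ => ∑ m, S m (K m * ρ * (K m)ᴴ)) E₂ φ := fun ρ hρ => by
  have hp := fun m => hρ.mul_mul_conjTranspose_same (K m ⊗ₖ (1 : Matrix ι₂ ι₂ ℂ))
  choose τ hτ hle using fun m => h m _ (hp m)
  refine ⟨∑ m, τ m, ?_, ?_⟩
  · have := IsScaledCoupling.sum hτ
    rw [← isLinearMap_map_sum hE₂.lin, sum_trace₁_conj_kronecker_one hK] at this
    simp only [trace₂_conj_kronecker_one] at this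
    have e := trace_sum_conj_mul K hK (trace₂ ρ)
    simp only [← trace₂_conj_kronecker_one, trace_trace₂] at e
    rwa [← Complex.re_sum, e] at this
  · rw [φ.expect_sum _ fun m => (hτ m).1, InfPred.expect_kraus _ _ hρ]
    exact Finset.sum_le_sum fun m _ => hle m

theorem ValidMap.branchR {κ : Type*} [Fintype κ] {K : κ → Matrix ι₂ ι₂ ℂ}
    (hK : ∑ m, (K m)ᴴ * K m = 1) {S : κ → Matrix ι₂ ι₂ ℂ → Matrix ι₂ ι₂ ℂ}
    {ξ : κ → InfPred (ι₁ × ι₂)} (hE₁ : QOp E₁) (h : ∀ m, ValidMap (ξ m) E₁ (S m) φ) :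
    ValidMap (InfPred.kraus (fun m => (1 : Matrix ι₁ ι₁ ℂ) ⊗ₖ K m) ξ) E₁
      (fun ρ => ∑ m, S m (K m * ρ * (K m)ᴴ)) φ := fun ρ hρ => by
  have hp := fun m => hρ.mul_mul_conjTranspose_same ((1 : Matrix ι₁ ι₁ ℂ) ⊗ₖ K m)
  choose τ hτ hle using fun m => h m _ (hp m)
  refine ⟨∑ m, τ m, ?_, ?_⟩
  · have := IsScaledCoupling.sum hτ
    rw [← isLinearMap_map_sum hE₁.lin, sum_trace₂_conj_one_kronecker hK] at this
    simp only [trace₁_conj_one_kronecker] at this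
    have e := trace_sum_conj_mul K hK (trace₁ ρ)
    simp only [← trace₁_conj_one_kronecker, trace_trace₁] at e
    rwa [← Complex.re_sum, e] at this
  · rw [φ.expect_sum _ fun m => (hτ m).1, InfPred.expect_kraus _ _ hρ]
    exact Finset.sum_le_sum fun m _ => hle m

theorem ValidMap.kraus {κ₁ κ₂ : Type*} [Fintype κ₁] [Fintype κ₂] {K : κ₁ → Matrix ι₁ ι₁ ℂ}
    (hK : ∑ m, (K m)ᴴ * K m = 1) {L : κ₂ → Matrix ι₂ ι₂ ℂ} (hL : ∑ m, (L m)ᴴ * L m = 1)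
    (ψ : InfPred (ι₁ × ι₂)) :
    ValidMap (InfPred.kraus (fun m : κ₁ × κ₂ => K m.1 ⊗ₖ L m.2) fun _ => ψ)
      (fun ρ => ∑ m, K m * ρ * (K m)ᴴ) (fun ρ => ∑ m, L m * ρ * (L m)ᴴ) ψ := by
  have h1 := ValidMap.branchR hL (S := fun _ ρ => ρ) QOp.id fun _ => ValidMap.id ψ
  have h2 := ValidMap.branchL hK (S := fun _ ρ => ρ) (.branch (fun _ => QOp.id) hL) fun _ => h1
  refine h2.conseq (InfPred.le_of_expect_le fun ρ hρ => ?_) fun _ => le_rfl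
  rw [InfPred.expect_kraus _ _ hρ, InfPred.expect_kraus _ _ hρ, Fintype.sum_prod_type]
  refine Finset.sum_le_sum fun i _ => ?_
  rw [InfPred.expect_kraus _ _ (hρ.mul_mul_conjTranspose_same _)]
  refine Finset.sum_le_sum fun j _ => le_of_eq ?_
  have e : K i ⊗ₖ L j = (1 : Matrix ι₁ ι₁ ℂ) ⊗ₖ L j * K i ⊗ₖ (1 : Matrix ι₂ ι₂ ℂ) := by
    rw [← Matrix.mul_kronecker_mul, one_mul, mul_one]
  rw [e, Matrix.conjTranspose_mul]
  simp only [mul_assoc]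

theorem ValidMap.of_tendsto {F₁ : ℕ → Matrix ι₁ ι₁ ℂ → Matrix ι₁ ι₁ ℂ}
    {F₂ : ℕ → Matrix ι₂ ι₂ ℂ → Matrix ι₂ ι₂ ℂ} (hF₁ : ∀ n, QOp (F₁ n))
    (h₁ : ∀ ρ, Filter.Tendsto (fun n => F₁ n ρ) Filter.atTop (nhds (E₁ ρ)))
    (h₂ : ∀ ρ, Filter.Tendsto (fun n => F₂ n ρ) Filter.atTop (nhds (E₂ ρ)))
    (h : ∀ n, ValidMap ψ (F₁ n) (F₂ n) φ) : ValidMap ψ E₁ E₂ φ := fun ρ hρ => by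
  choose σ hσ hle using fun n => h n ρ hρ
  have hc : IsCompact {A : Matrix (ι₁ × ι₂) (ι₁ × ι₂) ℂ | A.PosSemidef ∧ A.trace.re ≤ ρ.trace.re} :=
    isCompact_setOf_posSemidef_trace_le _
  have hmem : ∀ n, σ n ∈
      {A : Matrix (ι₁ × ι₂) (ι₁ × ι₂) ℂ | A.PosSemidef ∧ A.trace.re ≤ ρ.trace.re} := fun n =>
    ⟨(hσ n).1, (hσ n).trace_le_left.trans
      (((hF₁ n).trace_le _ (posSemidef_trace₂ hρ)).trans (by rw [trace_trace₂]))⟩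
  have : FirstCountableTopology (Matrix (ι₁ × ι₂) (ι₁ × ι₂) ℂ) :=
    inferInstanceAs (FirstCountableTopology (ι₁ × ι₂ → ι₁ × ι₂ → ℂ))
  obtain ⟨τ, -, u, hu, hτ⟩ := hc.tendsto_subseq hmem
  have t₁ := (h₁ (trace₂ ρ)).comp hu.tendsto_atTop
  have t₂ := (h₂ (trace₁ ρ)).comp hu.tendsto_atTop
  have hcl := (φ.isClosed_setOf_expect_le (ψ.expect ρ)).mem_of_tendsto hτ
    (Filter.Eventually.of_forall fun n => ⟨(hσ (u n)).1, hle (u n)⟩)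
  refine ⟨τ, ⟨hcl.1, ?_, ?_, ?_⟩, hcl.2⟩
  · exact isClosed_setOf_posSemidef.mem_of_tendsto
      (t₁.sub ((continuous_trace₂.tendsto τ).comp hτ))
      (Filter.Eventually.of_forall fun n => (hσ (u n)).2)
  · exact isClosed_setOf_posSemidef.mem_of_tendsto
      (t₂.sub ((continuous_trace₁.tendsto τ).comp hτ))
      (Filter.Eventually.of_forall fun n => (hσ (u n)).3)
  · exact le_of_tendsto_of_tendsto' (((continuous_trace_re.tendsto _).comp t₁).add ((continuous_trace_re.tendsto _).comp t₂))
      (((continuous_trace_re.tendsto _).comp hτ).const_add _) fun n => (hσ (u n)).4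

variable {K₀ K₁ : Matrix ι₁ ι₁ ℂ} {L₀ L₁ : Matrix ι₂ ι₂ ℂ}

theorem ValidMap.loop (hE₁ : QOp E₁) (hE₂ : QOp E₂) (hK : K₀ᴴ * K₀ + K₁ᴴ * K₁ = 1)
    (hL : L₀ᴴ * L₀ + L₁ᴴ * L₁ = 1) (hM : MeasCond ![K₀, K₁] ![L₀, L₁] ψ ![φ, ξ])
    (h : ValidMap ξ E₁ E₂ ψ) : ValidMap ψ (loopSem K₀ K₁ E₁) (loopSem L₀ L₁ E₂) φ := by
  refine .of_tendsto (qop_loopApprox hE₁ hK) (tendsto_loopApprox hE₁ hK)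
    (tendsto_loopApprox hE₂ hL) fun n => ?_
  induction n with
  | zero =>
    rw [loopApprox_zero, loopApprox_zero]
    refine fun ρ hρ => ⟨0, ⟨.zero, ?_, ?_, ?_⟩, by simp⟩
    · simpa [isLinearMap_trace₂.map_zero] using Matrix.PosSemidef.zero
    · simpa [isLinearMap_trace₁.map_zero] using Matrix.PosSemidef.zero
    · simpa using trace_re_nonneg hρ
  | succ n ih =>
    rw [loopApprox_succ, loopApprox_succ]
    refine .branch (by simpa using hK) (by simpa using hL) ?_ ?_ hM ?_
    · intro m
      fin_cases m
      exacts [QOp.id, (qop_loopApprox hE₁ hK n).comp hE₁]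
    · intro m
      fin_cases m
      exacts [QOp.id, (qop_loopApprox hE₂ hL n).comp hE₂]
    · have h' := h.comp (qop_loopApprox hE₁ hK n) (qop_loopApprox hE₂ hL n) ih
      intro m
      fin_cases m
      exacts [ValidMap.id φ, h']

theorem ValidMap.loopL (hE₁ : QOp E₁) (hK : K₀ᴴ * K₀ + K₁ᴴ * K₁ = 1)
    (h : ValidMap ξ E₁ (fun ρ => ρ)
      (InfPred.kraus (fun m => ![K₀, K₁] m ⊗ₖ (1 : Matrix ι₂ ι₂ ℂ)) ![φ, ξ])) :
    ValidMap (InfPred.kraus (fun m => ![K₀, K₁] m ⊗ₖ (1 : Matrix ι₂ ι₂ ℂ)) ![φ, ξ])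
      (loopSem K₀ K₁ E₁) (fun ρ => ρ) φ := by
  refine .of_tendsto (F₂ := fun _ ρ => ρ) (qop_loopApprox hE₁ hK) (tendsto_loopApprox hE₁ hK)
    (fun _ => tendsto_const_nhds) fun n => ?_
  induction n with
  | zero =>
    rw [loopApprox_zero]
    refine fun ρ hρ => ⟨0, ⟨.zero, ?_, ?_, ?_⟩, by simp⟩
    · simpa [isLinearMap_trace₂.map_zero] using Matrix.PosSemidef.zero
    · simpa [isLinearMap_trace₁.map_zero] using posSemidef_trace₁ hρ
    · simp
  | succ n ih =>
    rw [loopApprox_succ]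
    have h' := h.comp (qop_loopApprox hE₁ hK n) QOp.id ih
    refine .branchL (by simpa using hK) QOp.id fun m => ?_
    fin_cases m
    exacts [ValidMap.id φ, h']

theorem ValidMap.loopR (hE₂ : QOp E₂) (hL : L₀ᴴ * L₀ + L₁ᴴ * L₁ = 1)
    (h : ValidMap ξ (fun ρ => ρ) E₂
      (InfPred.kraus (fun m => (1 : Matrix ι₁ ι₁ ℂ) ⊗ₖ ![L₀, L₁] m) ![φ, ξ])) :
    ValidMap (InfPred.kraus (fun m => (1 : Matrix ι₁ ι₁ ℂ) ⊗ₖ ![L₀, L₁] m) ![φ, ξ])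
      (fun ρ => ρ) (loopSem L₀ L₁ E₂) φ := by
  refine .of_tendsto (F₁ := fun _ ρ => ρ) (fun _ => QOp.id) (fun _ => tendsto_const_nhds)
    (tendsto_loopApprox hE₂ hL) fun n => ?_
  induction n with
  | zero =>
    rw [loopApprox_zero]
    refine fun ρ hρ => ⟨0, ⟨.zero, ?_, ?_, ?_⟩, by simp⟩
    · simpa [isLinearMap_trace₂.map_zero] using posSemidef_trace₂ hρ
    · simpa [isLinearMap_trace₁.map_zero] using Matrix.PosSemidef.zero
    · simp
  | succ n ih =>
    rw [loopApprox_succ]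
    have h' := h.comp QOp.id (qop_loopApprox hE₂ hL n) ih
    refine .branchR (by simpa using hL) QOp.id fun m => ?_
    fin_cases m
    exacts [ValidMap.id φ, h']

end ValidMap

/-! ### Duality -/

section Functionals

variable {ι : Type*} [Fintype ι] [DecidableEq ι]

/-- A real functional is given on Hermitian matrices by a Hermitian matrix. -/
theorem exists_isHermitian_trace_mul (f : Matrix ι ι ℂ →ₗ[ℝ] ℝ) :
    ∃ Y : Matrix ι ι ℂ, Y.IsHermitian ∧ ∀ X : Matrix ι ι ℂ, X.IsHermitian →
      f X = (Y * X).trace.re := by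
  let g : Matrix ι ι ℂ →ₗ[ℂ] ℂ := Module.Dual.extendRCLike (𝕜 := ℂ) f
  have hg : ∀ X, (g X).re = f X := fun X =>
    Module.Dual.re_extendRCLike_apply (𝕜 := ℂ) f X
  let Z : Matrix ι ι ℂ := Matrix.of fun j i => g (Matrix.single i j 1)
  have hZ : ∀ X, (Z * X).trace = g X := fun X => by
    conv_rhs => rw [Matrix.matrix_eq_sum_single X]
    have : ∀ i j, Matrix.single i j (X i j) = X i j • Matrix.single i j (1 : ℂ) := by
      intro i j; simp
    simp only [this, map_sum, map_smul]
    rw [Matrix.trace, Finset.sum_comm]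
    simp [Z, Matrix.mul_apply, mul_comm]
  refine ⟨(1 / 2 : ℂ) • (Z + Zᴴ), ?_, fun X hX => ?_⟩
  · ext i j
    simp [add_comm]
    ring
  · have h1 : (Zᴴ * X).trace = star (Z * X).trace := by
      rw [← Matrix.trace_conjTranspose, Matrix.conjTranspose_mul, hX.eq, Matrix.trace_mul_comm]
    rw [smul_mul_assoc, Matrix.trace_smul, add_mul, Matrix.trace_add, h1, hZ, ← hg]
    simp
    ring

theorem abs_trace_mul_re_le (Y : Matrix ι ι ℂ) {σ : Matrix ι ι ℂ} (hσ : σ.PosSemidef) :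
    |(Y * σ).trace.re| ≤ (∑ i, ∑ j, ‖Y i j‖) * σ.trace.re := by
  refine (Complex.abs_re_le_norm _).trans ?_
  simp only [Matrix.trace, Matrix.diag_apply, Matrix.mul_apply, Finset.sum_mul]
  refine (norm_sum_le _ _).trans (Finset.sum_le_sum fun i _ => ?_)
  refine (norm_sum_le _ _).trans (Finset.sum_le_sum fun j _ => ?_)
  rw [norm_mul]
  exact mul_le_mul_of_nonneg_left (norm_apply_le_trace_re hσ j i) (norm_nonneg _)

theorem exists_forall_posSemidef_add_smul_one {Y : Matrix ι ι ℂ} (hY : Y.IsHermitian) :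
    ∃ a₀ : ℝ, ∀ a, a₀ ≤ a → (Y + (a : ℂ) • (1 : Matrix ι ι ℂ)).PosSemidef := by
  refine ⟨∑ i, ∑ j, ‖Y i j‖, fun a ha => posSemidef_of_trace_mul_nonneg ?_ fun ρ hρ => ?_⟩
  · exact hY.add (by simp [Matrix.IsHermitian, Matrix.conjTranspose_smul])
  · rw [add_mul, smul_mul_assoc, one_mul, Matrix.trace_add, Complex.add_re, trace_ofReal_smul_re]
    have h1 := neg_le_of_abs_le (abs_trace_mul_re_le Y hρ)
    have h2 := mul_le_mul_of_nonneg_right ha (trace_re_nonneg hρ)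
    linarith

theorem trace_smul_add_smul_one_mul (Y A : Matrix ι ι ℂ) (c a : ℝ) :
    (((c : ℂ) • Y + (a : ℂ) • (1 : Matrix ι ι ℂ)) * A).trace.re =
      c * (Y * A).trace.re + a * A.trace.re := by
  rw [add_mul, smul_mul_assoc, smul_mul_assoc, one_mul, Matrix.trace_add, Complex.add_re,
    trace_ofReal_smul_re, trace_ofReal_smul_re]

end Functionals

section Duality

variable {ι₁ ι₂ : Type*} [Fintype ι₁] [Fintype ι₂] [DecidableEq ι₁] [DecidableEq ι₂]

/-- The map that sends a joint state to its marginals and its cost. -/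
noncomputable def marginalsAndCost (F : Matrix (ι₁ × ι₂) (ι₁ × ι₂) ℂ) :
    Matrix (ι₁ × ι₂) (ι₁ × ι₂) ℂ →ₗ[ℝ] Matrix ι₁ ι₁ ℂ × Matrix ι₂ ι₂ ℂ × ℝ where
  toFun σ := (trace₂ σ, trace₁ σ, (F * σ).trace.re)
  map_add' σ τ := by
    simp [isLinearMap_trace₂.map_add, isLinearMap_trace₁.map_add, mul_add]
  map_smul' c σ := by
    simp only [← Complex.coe_smul, isLinearMap_trace₂.map_smul, isLinearMap_trace₁.map_smul,
      mul_smul_comm, trace_ofReal_smul_re, RingHom.id_apply, Prod.smul_mk, smul_eq_mul]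

/-- Strong duality for couplings of minimal cost, for a finite cost operator. -/
theorem exists_coupling_of_dual_le {F : Matrix (ι₁ × ι₂) (ι₁ × ι₂) ℂ}
    {ρ₁ : Matrix ι₁ ι₁ ℂ} {ρ₂ : Matrix ι₂ ι₂ ℂ} (h₁ : ρ₁.PosSemidef) (h₂ : ρ₂.PosSemidef)
    (ht₁ : ρ₁.trace = 1) (ht₂ : ρ₂.trace = 1) {t : ℝ}
    (h : ∀ (n : ℕ) (φ₁ : Matrix ι₁ ι₁ ℂ) (φ₂ : Matrix ι₂ ι₂ ℂ), φ₁.PosSemidef → φ₂.PosSemidef →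
      (∀ σ : Matrix (ι₁ × ι₂) (ι₁ × ι₂) ℂ, σ.PosSemidef →
        (φ₁ * trace₂ σ).trace.re + (φ₂ * trace₁ σ).trace.re ≤
          (F * σ).trace.re + n * σ.trace.re) →
      (φ₁ * ρ₁).trace.re + (φ₂ * ρ₂).trace.re ≤ t + n) :
    ∃ σ, IsCoupling σ ρ₁ ρ₂ ∧ (F * σ).trace.re ≤ t := by
  let D : Set (Matrix (ι₁ × ι₂) (ι₁ × ι₂) ℂ) := {σ | σ.PosSemidef ∧ σ.trace.re = 1}
  have hDc : IsCompact D :=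
    (isCompact_setOf_posSemidef_trace_le 1).of_isClosed_subset
      (isClosed_setOf_posSemidef.inter (isClosed_eq continuous_trace_re continuous_const))
      fun σ hσ => ⟨hσ.1, hσ.2.le⟩
  have hDv : Convex ℝ D := by
    rintro σ ⟨hσ, hσ'⟩ τ ⟨hτ, hτ'⟩ a b ha hb hab
    simp only [← Complex.coe_smul]
    refine ⟨(posSemidef_smul hσ ha).add (posSemidef_smul hτ hb), ?_⟩
    rw [Matrix.trace_add, Complex.add_re, trace_ofReal_smul_re, trace_ofReal_smul_re, hσ', hτ']
    linarith
  have hT : Continuous (marginalsAndCost F) := LinearMap.continuous_of_finiteDimensional _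
  have hLv : Convex ℝ (({ρ₁} : Set (Matrix ι₁ ι₁ ℂ)) ×ˢ ({ρ₂} : Set (Matrix ι₂ ι₂ ℂ)) ×ˢ Set.Iic t) :=
    (convex_singleton _).prod ((convex_singleton _).prod (convex_Iic t))
  have hLc : IsClosed (({ρ₁} : Set (Matrix ι₁ ι₁ ℂ)) ×ˢ ({ρ₂} : Set (Matrix ι₂ ι₂ ℂ)) ×ˢ Set.Iic t) :=
    isClosed_singleton.prod (isClosed_singleton.prod isClosed_Iic)
  by_cases hdisj : Disjoint (marginalsAndCost F '' D)
      (({ρ₁} : Set (Matrix ι₁ ι₁ ℂ)) ×ˢ ({ρ₂} : Set (Matrix ι₂ ι₂ ℂ)) ×ˢ Set.Iic t)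
  swap
  · obtain ⟨_, ⟨σ, hσ, rfl⟩, e₁, e₂, e₃⟩ := Set.not_disjoint_iff.1 hdisj
    exact ⟨σ, ⟨hσ.1, e₁, e₂⟩, e₃⟩
  exfalso
  have : LocallyConvexSpace ℝ (Matrix ι₁ ι₁ ℂ) :=
    inferInstanceAs (LocallyConvexSpace ℝ (ι₁ → ι₁ → ℂ))
  have : LocallyConvexSpace ℝ (Matrix ι₂ ι₂ ℂ) :=
    inferInstanceAs (LocallyConvexSpace ℝ (ι₂ → ι₂ → ℂ))
  obtain ⟨f, u, v, hfu, huv, hfv⟩ := geometric_hahn_banach_compact_closed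
    (hDv.linear_image _) (hDc.image hT) hLv hLc hdisj
  obtain ⟨Y₁, hY₁, hf₁⟩ := exists_isHermitian_trace_mul
    (f.toLinearMap ∘ₗ LinearMap.inl ℝ (Matrix ι₁ ι₁ ℂ) (Matrix ι₂ ι₂ ℂ × ℝ))
  obtain ⟨Y₂, hY₂, hf₂⟩ := exists_isHermitian_trace_mul
    (f.toLinearMap ∘ₗ LinearMap.inr ℝ (Matrix ι₁ ι₁ ℂ) (Matrix ι₂ ι₂ ℂ × ℝ) ∘ₗ
      LinearMap.inl ℝ (Matrix ι₂ ι₂ ℂ) ℝ)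
  set y : ℝ := f (0, 0, 1)
  have hf : ∀ (A : Matrix ι₁ ι₁ ℂ) (B : Matrix ι₂ ι₂ ℂ) (x : ℝ), A.IsHermitian → B.IsHermitian →
      f (A, B, x) = (Y₁ * A).trace.re + (Y₂ * B).trace.re + x * y := by
    intro A B x hA hB
    rw [← hf₁ A hA, ← hf₂ B hB]
    have e : ((A, B, x) : Matrix ι₁ ι₁ ℂ × Matrix ι₂ ι₂ ℂ × ℝ) =
        (A, 0, 0) + (0, B, 0) + x • (0, 0, 1) := by simp
    rw [e, map_add, map_add, map_smul, smul_eq_mul]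
    rfl
  have hfD : ∀ σ ∈ D, (Y₁ * trace₂ σ).trace.re + (Y₂ * trace₁ σ).trace.re +
      (F * σ).trace.re * y < u := fun σ hσ => by
    rw [← hf _ _ _ (posSemidef_trace₂ hσ.1).1 (posSemidef_trace₁ hσ.1).1]
    exact hfu _ ⟨σ, hσ, rfl⟩
  have hfL : ∀ x ≤ t, v < (Y₁ * ρ₁).trace.re + (Y₂ * ρ₂).trace.re + x * y := fun x hx => by
    rw [← hf _ _ _ h₁.1 h₂.1]
    exact hfv _ ⟨rfl, rfl, hx⟩
  have hprod : ρ₁ ⊗ₖ ρ₂ ∈ D :=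
    ⟨h₁.kronecker h₂, by rw [Matrix.trace_kronecker, ht₁, ht₂]; simp⟩
  have hneg : y < 0 := by
    have hp := hfD _ hprod
    rw [trace₂_kronecker, trace₁_kronecker, ht₁, ht₂, one_smul, one_smul] at hp
    by_contra! hy0
    have hx := hfL (min t (F * ρ₁ ⊗ₖ ρ₂).trace.re) (min_le_left _ _)
    have := mul_le_mul_of_nonneg_right (min_le_right t (F * ρ₁ ⊗ₖ ρ₂).trace.re) hy0
    linarith
  obtain ⟨c, hc, hyc⟩ : ∃ c : ℝ, 0 < c ∧ y = -c := ⟨-y, by linarith, by ring⟩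
  simp only [hyc] at hfD hfL
  have hZ₁ : (((c⁻¹ : ℝ) : ℂ) • Y₁).IsHermitian := by
    simp [Matrix.IsHermitian, Matrix.conjTranspose_smul, hY₁.eq]
  have hZ₂ : (((c⁻¹ : ℝ) : ℂ) • Y₂).IsHermitian := by
    simp [Matrix.IsHermitian, Matrix.conjTranspose_smul, hY₂.eq]
  obtain ⟨a, ha⟩ := exists_forall_posSemidef_add_smul_one hZ₁
  obtain ⟨b₀, hb₀⟩ := exists_forall_posSemidef_add_smul_one hZ₂
  obtain ⟨n, hn⟩ := exists_nat_ge (a + b₀ + c⁻¹ * u)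
  obtain ⟨b, hb⟩ : ∃ b : ℝ, b = n - c⁻¹ * u - a := ⟨_, rfl⟩
  have hD : ∀ σ ∈ D, c⁻¹ * (Y₁ * trace₂ σ).trace.re + a + (c⁻¹ * (Y₂ * trace₁ σ).trace.re + b) ≤
      (F * σ).trace.re + n := fun σ hσ => by
    have h1 := mul_le_mul_of_nonneg_left (hfD σ hσ).le (inv_pos.2 hc).le
    have h2 : c⁻¹ * ((F * σ).trace.re * -c) = -(F * σ).trace.re := by field_simp
    rw [mul_add, mul_add, h2] at h1
    linarith
  have key := h n _ _ (ha a le_rfl) (hb₀ b (by linarith)) fun σ hσ => by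
    rw [trace_smul_add_smul_one_mul, trace_smul_add_smul_one_mul, trace_trace₂, trace_trace₁]
    rcases exists_eq_smul_density hσ with rfl | ⟨ht, σ', hσ', ht', he⟩
    · simp [isLinearMap_trace₂.map_zero, isLinearMap_trace₁.map_zero]
    · have h1 := mul_le_mul_of_nonneg_left (hD σ' ⟨hσ', by simp [ht']⟩) ht.le
      have e₁ : (Y₁ * trace₂ σ).trace.re = σ.trace.re * (Y₁ * trace₂ σ').trace.re := by
        conv_lhs => rw [he, isLinearMap_trace₂.map_smul, mul_smul_comm, trace_ofReal_smul_re]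
      have e₂ : (Y₂ * trace₁ σ).trace.re = σ.trace.re * (Y₂ * trace₁ σ').trace.re := by
        conv_lhs => rw [he, isLinearMap_trace₁.map_smul, mul_smul_comm, trace_ofReal_smul_re]
      have e₃ : (F * σ).trace.re = σ.trace.re * (F * σ').trace.re := by
        conv_lhs => rw [he, mul_smul_comm, trace_ofReal_smul_re]
      rw [e₁, e₂, e₃]
      linarith
  rw [trace_smul_add_smul_one_mul, trace_smul_add_smul_one_mul, ht₁, ht₂, Complex.one_re] at key
  have h1 := mul_lt_mul_of_pos_left (huv.trans (hfL t le_rfl)) (inv_pos.2 hc)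
  have h2 : c⁻¹ * (t * -c) = -t := by field_simp
  rw [mul_add, mul_add, h2] at h1
  linarith

/-- Strong duality for couplings of minimal cost, for an infinite-valued cost predicate. -/
theorem exists_coupling_of_dualitySet {φ : InfPred (ι₁ × ι₂)}
    {ρ₁ : Matrix ι₁ ι₁ ℂ} {ρ₂ : Matrix ι₂ ι₂ ℂ} (h₁ : ρ₁.PosSemidef) (h₂ : ρ₂.PosSemidef)
    (ht₁ : ρ₁.trace = 1) (ht₂ : ρ₂.trace = 1) {t : ℝ}
    (h : ∀ y ∈ dualitySet φ,
      (y.2.1.1 * ρ₁).trace.re + (y.2.2.1 * ρ₂).trace.re ≤ t + y.1) :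
    ∃ σ, IsCoupling σ ρ₁ ρ₂ ∧ φ.expect σ ≤ ENNReal.ofReal t := by
  have hk : ∀ k : ℕ, ∃ σ, IsCoupling σ ρ₁ ρ₂ ∧
      ((φ.fin + (((k + 1 : ℝ) : ℝ) : ℂ) • φ.inf) * σ).trace.re ≤ t := by
    intro k
    refine exists_coupling_of_dual_le h₁ h₂ ht₁ ht₂ fun n φ₁ φ₂ hφ₁ hφ₂ hle =>
      h (n, ⟨φ₁, hφ₁⟩, ⟨φ₂, hφ₂⟩) (InfPred.le_of_expect_le fun σ hσ => ?_)
    have hf := trace_mul_re_nonneg φ.fin_posSemidef hσ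
    have hi := trace_mul_re_nonneg φ.inf_posSemidef hσ
    rw [expect_split, InfPred.expect_add _ _ hσ, InfPred.expect_natId, φ.expect_eq_ev hσ]
    refine (ENNReal.ofReal_le_ofReal (hle σ hσ)).trans ?_
    refine ENNReal.ofReal_add_le.trans (add_le_add_left ?_ _)
    rw [add_mul, Matrix.trace_add, Complex.add_re, smul_mul_assoc, trace_ofReal_smul_re]
    refine ENNReal.ofReal_add_le.trans (add_le_add_right ?_ _)
    rw [ENNReal.ofReal_mul (by positivity)]
    gcongr
    exact le_top
  choose σ hσ hle using hk
  have hle' : ∀ k : ℕ, (φ.fin * σ k).trace.re + (k + 1 : ℝ) * (φ.inf * σ k).trace.re ≤ t :=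
    fun k => by
      have := hle k
      rwa [add_mul, Matrix.trace_add, Complex.add_re, smul_mul_assoc, trace_ofReal_smul_re] at this
  have hf := fun k => trace_mul_re_nonneg φ.fin_posSemidef (hσ k).1
  have hi := fun k => trace_mul_re_nonneg φ.inf_posSemidef (hσ k).1
  have hmem : ∀ k, σ k ∈ {A : Matrix (ι₁ × ι₂) (ι₁ × ι₂) ℂ | A.PosSemidef ∧ A.trace.re ≤ 1} :=
    fun k => ⟨(hσ k).1, by rw [← trace_trace₂, (hσ k).2, ht₁, Complex.one_re]⟩
  have : FirstCountableTopology (Matrix (ι₁ × ι₂) (ι₁ × ι₂) ℂ) :=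
    inferInstanceAs (FirstCountableTopology (ι₁ × ι₂ → ι₁ × ι₂ → ℂ))
  obtain ⟨τ, hτm, w, hw, hτ⟩ := (isCompact_setOf_posSemidef_trace_le 1).tendsto_subseq hmem
  have hmul : ∀ A : Matrix (ι₁ × ι₂) (ι₁ × ι₂) ℂ, Filter.Tendsto
      (fun k => (A * σ (w k)).trace.re) Filter.atTop (nhds (A * τ).trace.re) := fun A =>
    (continuous_trace_re.tendsto _).comp (hτ.const_mul A)
  have hzero : (φ.inf * τ).trace.re ≤ 0 := by
    have hlim : Filter.Tendsto (fun k : ℕ => t * (1 / ((w k : ℝ) + 1))) Filter.atTop (nhds 0) := by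
      simpa using (tendsto_one_div_add_atTop_nhds_zero_nat.comp hw.tendsto_atTop).const_mul t
    refine le_of_tendsto_of_tendsto' (hmul φ.inf) hlim fun k => ?_
    rw [mul_one_div, le_div_iff₀ (by positivity)]
    linarith [hle' (w k), hf (w k)]
  have hfin : (φ.fin * τ).trace.re ≤ t := by
    refine le_of_tendsto' (hmul φ.fin) fun k => ?_
    have := mul_nonneg (by positivity : (0 : ℝ) ≤ (w k : ℝ) + 1) (hi (w k))
    linarith [hle' (w k)]
  refine ⟨τ, ⟨hτm.1, ?_, ?_⟩, ?_⟩
  · refine tendsto_nhds_unique ((continuous_trace₂.tendsto τ).comp hτ) ?_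
    simp [Function.comp_def, fun k => (hσ k).2]
  · refine tendsto_nhds_unique ((continuous_trace₁.tendsto τ).comp hτ) ?_
    simp [Function.comp_def, fun k => (hσ k).3]
  · rw [φ.expect_eq_ev hτm.1, ev, ENNReal.ofReal_of_nonpos hzero, mul_zero, add_zero]
    exact ENNReal.ofReal_le_ofReal hfin

theorem ValidMap.duality {ψ φ : InfPred (ι₁ × ι₂)} {E₁ : Matrix ι₁ ι₁ ℂ → Matrix ι₁ ι₁ ℂ}
    {E₂ : Matrix ι₂ ι₂ ℂ → Matrix ι₂ ι₂ ℂ} (hE₁ : QOp E₁) (hE₂ : QOp E₂)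
    (ht₁ : ∀ ρ, ρ.PosSemidef → ρ.trace = 1 → (E₁ ρ).trace = 1)
    (ht₂ : ∀ ρ, ρ.PosSemidef → ρ.trace = 1 → (E₂ ρ).trace = 1)
    (h : ∀ y ∈ dualitySet φ, ValidMap (ψ + InfPred.natId y.1) E₁ E₂ (split y.2.1 y.2.2)) :
    ValidMap ψ E₁ E₂ φ := by
  refine .of_density hE₁ hE₂ fun ρ hρ ht hψ => ?_
  have t₁ := ht₁ _ (posSemidef_trace₂ hρ) ((trace_trace₂ ρ).trans ht)
  have t₂ := ht₂ _ (posSemidef_trace₁ hρ) ((trace_trace₁ ρ).trans ht)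
  obtain ⟨σ, hσ, hle⟩ := exists_coupling_of_dualitySet (φ := φ) (t := (ψ.expect ρ).toReal)
    (hE₁.psd _ (posSemidef_trace₂ hρ)) (hE₂.psd _ (posSemidef_trace₁ hρ)) t₁ t₂ fun y hy => by
      obtain ⟨σ, hσ, hle⟩ := h y hy ρ hρ
      have hc := hσ.isCoupling (by rw [t₁, ht]) (by rw [t₂, ht])
      rw [expect_split, hc.2, hc.3, InfPred.expect_add _ _ hρ, InfPred.expect_natId, ht,
        Complex.one_re, mul_one, ← ENNReal.ofReal_toReal hψ,
        ← ENNReal.ofReal_add ENNReal.toReal_nonneg (Nat.cast_nonneg _)] at hle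
      exact (ENNReal.ofReal_le_ofReal_iff (by positivity)).1 hle
  have hs := IsScaledCoupling.of_isCoupling hσ
  rw [ENNReal.ofReal_toReal hψ] at hle
  refine ⟨σ, ?_, hle⟩
  rwa [← trace_trace₂, hσ.2, t₁] at hs

end Duality

/-! ### Soundness -/

section Soundness

variable {V₁ V₂ : Type*} [Fintype V₁] [DecidableEq V₁] [Fintype V₂] [DecidableEq V₂]
  {d₁ : V₁ → ℕ} {d₂ : V₂ → ℕ}

theorem Prog.AST.trace_eq_one {V : Type*} [Fintype V] [DecidableEq V] {d : V → ℕ} {c : Prog d}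
    (hc : c.AST) (ρ : Matrix (Basis d) (Basis d) ℂ) (hρ : ρ.PosSemidef) (ht : ρ.trace = 1) :
    (c.sem ρ).trace = 1 := by
  rw [hc ρ hρ (by simp [ht]), ht]

theorem Prog.AST.trace_eq {V : Type*} [Fintype V] [DecidableEq V] {d : V → ℕ} {c : Prog d}
    (hc : c.AST) {ρ : Matrix (Basis d) (Basis d) ℂ} (hρ : ρ.PosSemidef) :
    (c.sem ρ).trace = ρ.trace := by
  rcases exists_eq_smul_density hρ with rfl | ⟨-, ρ', hρ', ht, he⟩
  · rw [c.qop_sem.lin.map_zero]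
  · rw [he, c.qop_sem.lin.map_smul, Matrix.trace_smul, Matrix.trace_smul,
      hc.trace_eq_one ρ' hρ' ht, ht]

theorem eq_vecCons_two {α : Type*} (f : Fin 2 → α) : f = ![f 0, f 1] := by
  ext i
  fin_cases i <;> rfl

theorem Derivable.validMap {ψ φ : RelAssn d₁ d₂} {c₁ : Prog d₁} {c₂ : Prog d₂}
    (h : Derivable ψ c₁ c₂ φ) : ValidMap ψ c₁.sem c₂.sem φ := by
  induction h with
  | skip ψ => exact ValidMap.id ψ
  | init Q₁ w₁ h₁ Q₂ w₂ h₂ ψ => exact ValidMap.kraus (sum_initKraus h₁) (sum_initKraus h₂) ψ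
  | apply Q₁ U₁ Q₂ U₂ ψ =>
    have h := ValidMap.kraus (κ₁ := Unit) (κ₂ := Unit) (K := fun _ => lift Q₁ U₁.1)
      (L := fun _ => lift Q₂ U₂.1) (by simpa using lift_unitary Q₁ U₁)
      (by simpa using lift_unitary Q₂ U₂) ψ
    simp only [Finset.univ_unique, Finset.sum_singleton] at h
    refine ValidMap.conseq (InfPred.le_of_expect_le fun ρ hρ => ?_) h fun _ => le_rfl
    simp [InfPred.expect_kraus _ _ hρ]
  | @seq _ _ _ c₁ c₁' c₂ c₂' _ _ h h' =>
    exact ValidMap.comp (F₁ := c₁'.sem) (F₂ := c₂'.sem) (Prog.qop_sem _) (Prog.qop_sem _) h h'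
  | cond ξ hM _ ih =>
    exact ValidMap.branch (Measurement.sum_lifted _) (Measurement.sum_lifted _)
      (fun _ => Prog.qop_sem _) (fun _ => Prog.qop_sem _) hM ih
  | @loop Q₁ Q₂ M₁ M₂ c₁ c₂ ψ φ ξ hM _ ih =>
    rw [eq_vecCons_two M₁.lifted, eq_vecCons_two M₂.lifted] at hM
    exact ValidMap.loop (Prog.qop_sem c₁) (Prog.qop_sem c₂) M₁.lifted_add M₂.lifted_add hM ih
  | initL Q w h ψ =>
    exact ValidMap.branchL (S := fun _ ρ => ρ) (sum_initKraus h) QOp.id fun _ => ValidMap.id ψ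
  | applyL Q U ψ =>
    have h := ValidMap.branchL (κ := Unit) (K := fun _ => lift Q U.1) (S := fun _ ρ => ρ)
      (by simpa using lift_unitary Q U) QOp.id fun _ => ValidMap.id ψ
    simp only [Finset.univ_unique, Finset.sum_singleton] at h
    exact h
  | condL ξ _ ih => exact ValidMap.branchL (Measurement.sum_lifted _) (Prog.qop_sem _) ih
  | @loopL Q M c φ ξ _ ih =>
    have e : (fun m => onL (M.lifted m)) =
        fun m => ![M.lifted 0, M.lifted 1] m ⊗ₖ (1 : Matrix (Basis d₂) (Basis d₂) ℂ) := by
      rw [← eq_vecCons_two M.lifted]; rfl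
    rw [e] at ih ⊢
    exact ValidMap.loopL (Prog.qop_sem c) M.lifted_add ih
  | initR Q w h ψ =>
    exact ValidMap.branchR (S := fun _ ρ => ρ) (sum_initKraus h) QOp.id fun _ => ValidMap.id ψ
  | applyR Q U ψ =>
    have h := ValidMap.branchR (κ := Unit) (K := fun _ => lift Q U.1) (S := fun _ ρ => ρ)
      (by simpa using lift_unitary Q U) QOp.id fun _ => ValidMap.id ψ
    simp only [Finset.univ_unique, Finset.sum_singleton] at h
    exact h
  | condR ξ _ ih => exact ValidMap.branchR (Measurement.sum_lifted _) (Prog.qop_sem _) ih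
  | @loopR Q M c φ ξ _ ih =>
    have e : (fun m => onR (M.lifted m)) =
        fun m => (1 : Matrix (Basis d₁) (Basis d₁) ℂ) ⊗ₖ ![M.lifted 0, M.lifted 1] m := by
      rw [← eq_vecCons_two M.lifted]; rfl
    rw [e] at ih ⊢
    exact ValidMap.loopR (Prog.qop_sem c) M.lifted_add ih
  | same h₁ h₂ _ ih => rwa [← h₁.sem_eq, ← h₂.sem_eq]
  | conseq hψ _ hφ ih => exact ih.conseq hψ hφ
  | boundedDuality h₁ h₂ _ _ ih =>
    exact ValidMap.duality (Prog.qop_sem _) (Prog.qop_sem _) h₁.trace_eq_one h₂.trace_eq_one ih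
  | unboundedDuality h₁ h₂ _ ih =>
    exact ValidMap.duality (Prog.qop_sem _) (Prog.qop_sem _) h₁.trace_eq_one h₂.trace_eq_one ih

theorem ValidMap.validCoupling {ψ φ : RelAssn d₁ d₂} {c₁ : Prog d₁} {c₂ : Prog d₂}
    (h₁ : c₁.AST) (h₂ : c₂.AST) (h : ValidMap ψ c₁.sem c₂.sem φ) : ValidCoupling ψ c₁ c₂ φ :=
  fun ρ hρ _ => by
    obtain ⟨σ, hσ, hle⟩ := h ρ hρ
    exact ⟨σ, hσ.isCoupling (by rw [h₁.trace_eq (posSemidef_trace₂ hρ), trace_trace₂])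
      (by rw [h₂.trace_eq (posSemidef_trace₁ hρ), trace_trace₁]), hle⟩

theorem ValidCoupling.valid {ψ φ : RelAssn d₁ d₂} {c₁ : Prog d₁} {c₂ : Prog d₂}
    (h₁ : c₁.AST) (h : ValidCoupling ψ c₁ c₂ φ) : Valid ψ c₁ c₂ φ :=
  fun ρ hρ ht => by
    obtain ⟨σ, hσ, hle⟩ := h ρ hρ (by simp [ht])
    refine ⟨σ, isScaledCoupling_one_iff.1 ?_, hle⟩
    have hs := IsScaledCoupling.of_isCoupling hσ
    rwa [← trace_trace₂, hσ.2,
      h₁.trace_eq_one _ (posSemidef_trace₂ hρ) ((trace_trace₂ ρ).trans ht)] at hs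

theorem Valid.validMap {ψ φ : RelAssn d₁ d₂} {c₁ : Prog d₁} {c₂ : Prog d₂}
    (h : Valid ψ c₁ c₂ φ) : ValidMap ψ c₁.sem c₂.sem φ :=
  .of_density (Prog.qop_sem _) (Prog.qop_sem _) fun ρ hρ ht _ => by
    obtain ⟨σ, hσ, hle⟩ := h ρ hρ ht
    exact ⟨σ, isScaledCoupling_one_iff.2 hσ, hle⟩

end Soundness

/-! ### Completeness -/

section Completeness

variable {ι : Type*} [Fintype ι] [DecidableEq ι]

/-- `∑ k, (K k)† P (K k)` as a predicate, for positive operators. -/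
theorem InfPred.kraus_ofPos {κ : Type*} [Fintype κ] (K : κ → Matrix ι ι ℂ)
    (A : κ → InfPred ι) (hA : ∀ k, (A k).inf = 0) {B : Matrix ι ι ℂ} (hB : B.PosSemidef)
    (h : ∑ k, (K k)ᴴ * (A k).fin * K k = B) : kraus K A = ofPos B hB := by
  subst h
  ext1 <;> simp [kraus, ofParts, ofPos, hA, suppProj_zero]

theorem ValidMap.split_le {ι₁ ι₂ : Type*} [Fintype ι₁] [Fintype ι₂] [DecidableEq ι₁]
    [DecidableEq ι₂] {ψ φ : InfPred (ι₁ × ι₂)} {E₁ : Matrix ι₁ ι₁ ℂ → Matrix ι₁ ι₁ ℂ}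
    {E₂ : Matrix ι₂ ι₂ ℂ → Matrix ι₂ ι₂ ℂ}
    (h₁ : ∀ ρ, ρ.PosSemidef → (E₁ ρ).trace = ρ.trace)
    (h₂ : ∀ ρ, ρ.PosSemidef → (E₂ ρ).trace = ρ.trace) (h : ValidMap ψ E₁ E₂ φ) {n : ℕ}
    {P₁ Q₁ : {P : Matrix ι₁ ι₁ ℂ // P.PosSemidef}} {P₂ Q₂ : {P : Matrix ι₂ ι₂ ℂ // P.PosSemidef}}
    (hP : split P₁ P₂ ≤ φ + InfPred.natId n)
    (hQ₁ : ∀ ρ, (Q₁.1 * ρ).trace = (P₁.1 * E₁ ρ).trace)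
    (hQ₂ : ∀ ρ, (Q₂.1 * ρ).trace = (P₂.1 * E₂ ρ).trace) :
    split Q₁ Q₂ ≤ ψ + InfPred.natId n := by
  refine InfPred.le_of_expect_le fun ρ hρ => ?_
  obtain ⟨σ, hσ, hle⟩ := h ρ hρ
  have hc := hσ.isCoupling (by rw [h₁ _ (posSemidef_trace₂ hρ), trace_trace₂])
    (by rw [h₂ _ (posSemidef_trace₁ hρ), trace_trace₁])
  have ht : σ.trace = ρ.trace := by
    rw [← trace_trace₂, hc.2, h₁ _ (posSemidef_trace₂ hρ), trace_trace₂]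
  refine le_trans (le_of_eq ?_) ((InfPred.expect_mono hP hσ.1).trans ?_)
  · rw [expect_split, expect_split, hQ₁, hQ₂, hc.2, hc.3]
  · rw [InfPred.expect_add _ _ hσ.1, InfPred.expect_add _ _ hρ, InfPred.expect_natId,
      InfPred.expect_natId, ht]
    gcongr

variable {V₁ V₂ : Type*} [Fintype V₁] [DecidableEq V₁] [Fintype V₂] [DecidableEq V₂]
  {d₁ : V₁ → ℕ} {d₂ : V₂ → ℕ}

theorem kraus_onL_split {κ : Type*} [Fintype κ] {K : κ → Matrix (Basis d₁) (Basis d₁) ℂ}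
    (hK : ∑ k, (K k)ᴴ * K k = 1)
    (P : κ → {P : Matrix (Basis d₁) (Basis d₁) ℂ // P.PosSemidef})
    (R : {P : Matrix (Basis d₂) (Basis d₂) ℂ // P.PosSemidef})
    (Q : {P : Matrix (Basis d₁) (Basis d₁) ℂ // P.PosSemidef})
    (h : ∀ ρ, (Q.1 * ρ).trace = ∑ k, ((P k).1 * (K k * ρ * (K k)ᴴ)).trace) :
    InfPred.kraus (fun k => onL (K k)) (fun k => split (P k) R) = split Q R := by
  refine InfPred.kraus_ofPos _ _ (fun _ => rfl) _ (eq_of_trace_mul_eq fun ρ => ?_)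
  rw [trace_split_mul, h, ← sum_trace₁_conj_kronecker_one hK ρ, Finset.sum_mul, Matrix.trace_sum,
    Finset.mul_sum, Matrix.trace_sum, ← Finset.sum_add_distrib]
  refine Finset.sum_congr rfl fun k _ => ?_
  rw [← trace₂_conj_kronecker_one, ← trace_split_mul]
  change ((onL (K k))ᴴ * _ * onL (K k) * ρ).trace = (_ * (onL (K k) * ρ * (onL (K k))ᴴ)).trace
  rw [mul_assoc, mul_assoc, Matrix.trace_mul_comm, mul_assoc]
  rfl

theorem kraus_onR_split {κ : Type*} [Fintype κ] {K : κ → Matrix (Basis d₂) (Basis d₂) ℂ}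
    (hK : ∑ k, (K k)ᴴ * K k = 1)
    (P : κ → {P : Matrix (Basis d₂) (Basis d₂) ℂ // P.PosSemidef})
    (R : {P : Matrix (Basis d₁) (Basis d₁) ℂ // P.PosSemidef})
    (Q : {P : Matrix (Basis d₂) (Basis d₂) ℂ // P.PosSemidef})
    (h : ∀ ρ, (Q.1 * ρ).trace = ∑ k, ((P k).1 * (K k * ρ * (K k)ᴴ)).trace) :
    InfPred.kraus (fun k => onR (K k)) (fun k => split R (P k)) = split R Q := by
  refine InfPred.kraus_ofPos _ _ (fun _ => rfl) _ (eq_of_trace_mul_eq fun ρ => ?_)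
  rw [trace_split_mul, h, ← sum_trace₂_conj_one_kronecker hK ρ, Finset.sum_mul, Matrix.trace_sum,
    Finset.mul_sum, Matrix.trace_sum, ← Finset.sum_add_distrib]
  refine Finset.sum_congr rfl fun k _ => ?_
  rw [← trace₁_conj_one_kronecker, ← trace_split_mul]
  change ((onR (K k))ᴴ * _ * onR (K k) * ρ).trace = (_ * (onR (K k) * ρ * (onR (K k))ᴴ)).trace
  rw [mul_assoc, mul_assoc, Matrix.trace_mul_comm, mul_assoc]
  rfl

/-- The one-sided rules derive the weakest preconditions of split predicates. -/
theorem derivable_split_left (c : Prog d₁)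
    (P Q : {P : Matrix (Basis d₁) (Basis d₁) ℂ // P.PosSemidef})
    (h : ∀ ρ, (Q.1 * ρ).trace = (P.1 * c.sem ρ).trace)
    (R : {P : Matrix (Basis d₂) (Basis d₂) ℂ // P.PosSemidef}) :
    Derivable (split Q R) c .skip (split P R) := by
  induction c generalizing P Q with
  | skip =>
    obtain rfl : Q = P := Subtype.ext (eq_of_trace_mul_eq h)
    exact .skip _
  | init Q' w hw =>
    rw [← kraus_onL_split (sum_initKraus hw) (fun _ => P) R Q fun ρ => by
      rw [h, Prog.sem, Finset.mul_sum, Matrix.trace_sum]]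
    exact .initL _ _ _ _
  | apply Q' U =>
    rw [← kraus_onL_split (κ := Unit) (K := fun _ => lift Q' U.1)
      (by simpa using lift_unitary Q' U) (fun _ => P) R Q fun ρ => by
        rw [h, Prog.sem]; simp]
    exact .applyL _ _ _
  | seq c c' ih ih' =>
    obtain ⟨Q', hQ', hQ''⟩ := c'.qop_sem.exists_adjoint P.2
    exact .same (.refl _) (.skip_seq _)
      (.seq (ih ⟨Q', hQ'⟩ Q fun ρ => by rw [h, hQ'', Prog.sem]) (ih' P ⟨Q', hQ'⟩ hQ''))
  | cond Q' n M S ih =>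
    choose A hA hA' using fun m => (S m).qop_sem.exists_adjoint P.2
    rw [← kraus_onL_split M.sum_lifted (fun m => ⟨A m, hA m⟩) R Q fun ρ => by
      simp only [h, Prog.sem, Finset.mul_sum, Matrix.trace_sum, hA']]
    exact .condL _ fun m => ih m P _ (hA' m)
  | loop Q' M c ih =>
    obtain ⟨A, hA, hA'⟩ := c.qop_sem.exists_adjoint Q.2
    have e : InfPred.kraus (fun m => onL (M.lifted m)) ![split P R, split ⟨A, hA⟩ R] =
        split Q R := by
      rw [← kraus_onL_split M.sum_lifted ![P, ⟨A, hA⟩] R Q fun ρ => ?_]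
      · congr 1
        ext1 m
        fin_cases m <;> rfl
      · have hl := loopSem_eq c.qop_sem M.lifted_add ρ
        have h' : ∀ ρ, (Q.1 * ρ).trace =
          (P.1 * loopSem (M.lifted 0) (M.lifted 1) c.sem ρ).trace := h
        rw [h', hl, mul_add, Matrix.trace_add, ← h', ← hA', Fin.sum_univ_two]
        rfl
    rw [← e]
    refine .loopL ?_
    rw [e]
    exact ih Q ⟨A, hA⟩ hA'

theorem derivable_split_right (c : Prog d₂)
    (P Q : {P : Matrix (Basis d₂) (Basis d₂) ℂ // P.PosSemidef})
    (h : ∀ ρ, (Q.1 * ρ).trace = (P.1 * c.sem ρ).trace)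
    (R : {P : Matrix (Basis d₁) (Basis d₁) ℂ // P.PosSemidef}) :
    Derivable (split R Q) .skip c (split R P) := by
  induction c generalizing P Q with
  | skip =>
    obtain rfl : Q = P := Subtype.ext (eq_of_trace_mul_eq h)
    exact .skip _
  | init Q' w hw =>
    rw [← kraus_onR_split (sum_initKraus hw) (fun _ => P) R Q fun ρ => by
      rw [h, Prog.sem, Finset.mul_sum, Matrix.trace_sum]]
    exact .initR _ _ _ _
  | apply Q' U =>
    rw [← kraus_onR_split (κ := Unit) (K := fun _ => lift Q' U.1)
      (by simpa using lift_unitary Q' U) (fun _ => P) R Q fun ρ => by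
        rw [h, Prog.sem]; simp]
    exact .applyR _ _ _
  | seq c c' ih ih' =>
    obtain ⟨Q', hQ', hQ''⟩ := c'.qop_sem.exists_adjoint P.2
    exact .same (.skip_seq _) (.refl _)
      (.seq (ih ⟨Q', hQ'⟩ Q fun ρ => by rw [h, hQ'', Prog.sem]) (ih' P ⟨Q', hQ'⟩ hQ''))
  | cond Q' n M S ih =>
    choose A hA hA' using fun m => (S m).qop_sem.exists_adjoint P.2
    rw [← kraus_onR_split M.sum_lifted (fun m => ⟨A m, hA m⟩) R Q fun ρ => by
      simp only [h, Prog.sem, Finset.mul_sum, Matrix.trace_sum, hA']]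
    exact .condR _ fun m => ih m P _ (hA' m)
  | loop Q' M c ih =>
    obtain ⟨A, hA, hA'⟩ := c.qop_sem.exists_adjoint Q.2
    have e : InfPred.kraus (fun m => onR (M.lifted m)) ![split R P, split R ⟨A, hA⟩] =
        split R Q := by
      rw [← kraus_onR_split M.sum_lifted ![P, ⟨A, hA⟩] R Q fun ρ => ?_]
      · congr 1
        ext1 m
        fin_cases m <;> rfl
      · have hl := loopSem_eq c.qop_sem M.lifted_add ρ
        have h' : ∀ ρ, (Q.1 * ρ).trace =
          (P.1 * loopSem (M.lifted 0) (M.lifted 1) c.sem ρ).trace := h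
        rw [h', hl, mul_add, Matrix.trace_add, ← h', ← hA', Fin.sum_univ_two]
        rfl
    rw [← e]
    refine .loopR ?_
    rw [e]
    exact ih Q ⟨A, hA⟩ hA'

theorem ValidMap.derivable {ψ φ : RelAssn d₁ d₂} {c₁ : Prog d₁} {c₂ : Prog d₂}
    (h₁ : c₁.AST) (h₂ : c₂.AST) (h : ValidMap ψ c₁.sem c₂.sem φ) : Derivable ψ c₁ c₂ φ := by
  refine .unboundedDuality h₁ h₂ fun y hy => ?_
  obtain ⟨Q₁, hQ₁, hQ₁'⟩ := c₁.qop_sem.exists_adjoint y.2.1.2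
  obtain ⟨Q₂, hQ₂, hQ₂'⟩ := c₂.qop_sem.exists_adjoint y.2.2.2
  have hle : split ⟨Q₁, hQ₁⟩ ⟨Q₂, hQ₂⟩ ≤ ψ + InfPred.natId y.1 :=
    h.split_le (fun _ => h₁.trace_eq) (fun _ => h₂.trace_eq) hy hQ₁' hQ₂'
  have hl := derivable_split_left c₁ y.2.1 ⟨Q₁, hQ₁⟩ hQ₁' ⟨Q₂, hQ₂⟩
  have hr := derivable_split_right c₂ y.2.2 ⟨Q₂, hQ₂⟩ hQ₂' y.2.1
  have hd := Derivable.same (Prog.Same.seq_skip c₁) (Prog.Same.skip_seq c₂) (hl.seq hr)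
  exact hd.conseq hle (InfPred.le_of_expect_le fun _ _ => le_rfl)

end Completeness

end QOTL

theorem mainTheorem6 {V₁ V₂ : Type*} [Fintype V₁] [DecidableEq V₁] [Fintype V₂] [DecidableEq V₂]
    (d₁ : V₁ → ℕ) (d₂ : V₂ → ℕ) [∀ v, NeZero (d₁ v)] [∀ v, NeZero (d₂ v)]
    (c₁ : QOTL.Prog d₁) (c₂ : QOTL.Prog d₂) (hc₁ : c₁.AST) (hc₂ : c₂.AST)
    (ψ φ : QOTL.RelAssn d₁ d₂) :
    (QOTL.Derivable ψ c₁ c₂ φ ↔ QOTL.Valid ψ c₁ c₂ φ) ∧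
    (QOTL.Derivable ψ c₁ c₂ φ ↔ QOTL.ValidCoupling ψ c₁ c₂ φ) := by
  have h : QOTL.ValidCoupling ψ c₁ c₂ φ → QOTL.Derivable ψ c₁ c₂ φ := fun h =>
    (h.valid hc₁).validMap.derivable hc₁ hc₂
  refine ⟨⟨fun h => (h.validMap.validCoupling hc₁ hc₂).valid hc₁,
    fun h => h.validMap.derivable hc₁ hc₂⟩, ⟨fun h => h.validMap.validCoupling hc₁ hc₂, h⟩⟩
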